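/- Let $A$ be an irreducible $k\times k$ matrix over $\mathbb{Z}_{\ge 0}$, and let $(X_A,\sigma_A)$ be its edge shift: $X_A$ is the space of bi-infinite paths in the directed graph with $A_{ij}$ edges from $i$ to $j$, and $(\sigma_A x)_i=x_{i+1}$. Assume that $h_{top}(\sigma_A)>0$. Let $\phi$ be an automorphism of $(X_A,\sigma_A)$, i.e. a homeomorphism of $X_A$ commuting with $\sigma_A$. Notation. Let $\lambda_A$ be the Perron--Frobenius eigenvalue (the spectral radius) of $A$. For $x\in X_A$ and $m\in\mathbb{Z}$ let $R(x,m)=\{y\in X_A : y_i=x_i \text{ for all } i\le m\}$ (an $m$-ray). The unstable set of $x$ is $W^u(x)=\bigcup_{n\in\mathbb{Z}}R(x,n)$, with the topology that has the rays $R(y,m)$, $y\in W^u(x)$, $m\in\mathbb{Z}$, as a basis. A canonical family of measures on unstable sets is a family $\mu=\{\mu^x\}_{x\in X_A}$ of Borel measures $\mu^x$ on $W^u(x)$ for which there is a positive right eigenvector $v$ of $A$ for $\lambda_A$ with $\mu^x(R(y,m))=\lambda_A^{-m}\,v(t(y_m))$ for all $x\in X_A$, $y\in W^u(x)$ and $m\in\mathbb{Z}$,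 where $t(e)$ is the terminal state of the edge $e$. An $m$-beam is a finite union of $m$-rays, and a beam is an $m$-beam for some $m$. For an $m$-beam $U$ let $v_{U,m}\in\mathbb{Z}^k$ be the vector whose $J$-th entry is the number of $m$-rays $R(y,m)\subseteq U$ with $t(y_m)=J$. Beams $U,V$ are equivalent if, for some $m$, both are $m$-beams and $v_{U,m}=v_{V,m}$. Let $D_A$ be the group completion of the semigroup of equivalence classes $[U]$ of beams, with $[U]+[V]=[U\cup V]$ for disjoint $U,V$, and let $\phi_*$ be the endomorphism of $D_A$ given by $\phi_*[U]=[\phi(U)]$. The state of a canonical family $\mu$ is a homomorphism $\tau_\mu\colon D_A\to\mathbb{R}$, nonnegative on classes of beams, with $\tau_\mu([R(x,n)])=\mu^x(R(x,n))$ for all $x$ and $n$. Matrices act on row vectors. Let $R(A)=\mathbb{Q}^kA^k$, let $\mathcal{G}_A=\{x\in R(A): xA^n\in\mathbb{Z}^k\text{ for some }n\ge0\}$, let $\mathcal{G}_A^+=\{x\in R(A): xA^n\in\mathbb{Z}_{\ge0}^k\text{ for some }n\ge0\}$, and let $\delta_A(x)=xA$. Let $\theta\colon D_A\to\mathcal{G}_A$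 be the homomorphism with $\theta([U])=\delta_A^{-k-n}(v_{U,n}A^k)$ for every $n$-beam $U$. Then: (i) a canonical family of measures on unstable sets exists, and every canonical family $\mu$ has exactly one state $\tau_\mu$; (ii) there is exactly one automorphism $S_\phi$ of $\mathcal{G}_A$ that maps $\mathcal{G}_A^+$ onto itself, commutes with $\delta_A$, and satisfies $S_\phi\circ\theta=\theta\circ\phi_*$; (iii) $\delta_A\otimes1$ has a nonzero eigenvector in $\mathcal{G}_A\otimes\mathbb{C}$ for the eigenvalue $\lambda_A$; (iv) there is a real number $\lambda_\phi>0$ such that - $\lambda_\phi$ is the unique real number $c$ for which $\mu^{\phi(x)}(\phi(S))=c\,\mu^x(S)$ for every canonical family $\mu$, every $x\in X_A$ and every Borel set $S\subseteq W^u(x)$; - $\lambda_\phi$ is the unique real number $c$ for which $\tau_\mu(\phi_*(d))=c\,\tau_\mu(d)$ for every canonical family $\mu$ and every $d\in D_A$; - $\lambda_\phi$ is the unique complex number $c$ for which $(S_\phi\otimes1)v=c\,v$ for every $v\in\mathcal{G}_A\otimes\mathbb{C}$ with $(\delta_A\otimes1)v=\lambda_A v$; - $\log\lambda_\phi\le h_{top}(\phi)$,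 and moreover $|\log\lambda_\phi|\le h_{top}(\phi)$. -/

import Mathlib

open Set Filter Topology MeasureTheory
open scoped Matrix TensorProduct

noncomputable section

namespace SFT

/-! ### Edge shifts -/

/-- The edges of the directed graph with vertex set `Fin k` that has `A i j` edges from `i`
to `j`. -/
structure Edge {k : ℕ} (A : Matrix (Fin k) (Fin k) ℕ) where
  /-- the initial state -/
  src : Fin k
  /-- the terminal state -/
  tgt : Fin k
  /-- the number of the edge among those from `src` to `tgt` -/
  idx : Fin (A src tgt)

/-- The alphabet carries the discrete uniformity. -/
instance {k : ℕ} (A : Matrix (Fin k) (Fin k) ℕ) : UniformSpace (Edge A) := ⊥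

instance {k : ℕ} (A : Matrix (Fin k) (Fin k) ℕ) : DiscreteUniformity (Edge A) := ⟨rfl⟩

instance {k : ℕ} (A : Matrix (Fin k) (Fin k) ℕ) : Finite (Edge A) :=
  Finite.of_injective
    (fun e : Edge A => (⟨(e.src, e.tgt), e.idx⟩ : Σ p : Fin k × Fin k, Fin (A p.1 p.2)))
    (by
      rintro ⟨a, b, c⟩ ⟨a', b', c'⟩ h
      simp only [Sigma.mk.injEq, Prod.mk.injEq] at h
      obtain ⟨⟨rfl, rfl⟩, h⟩ := h
      simpa using h)

/-- The edge shift `X_A`: bi-infinite paths in the graph of `A`, with the uniformity (and the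
topology) of pointwise convergence. -/
abbrev Shift {k : ℕ} (A : Matrix (Fin k) (Fin k) ℕ) : Type :=
  {x : ℤ → Edge A // ∀ i, (x i).tgt = (x (i + 1)).src}

instance {k : ℕ} (A : Matrix (Fin k) (Fin k) ℕ) : CoeFun (Shift A) (fun _ => ℤ → Edge A) :=
  ⟨Subtype.val⟩

section

variable {k : ℕ} {A : Matrix (Fin k) (Fin k) ℕ}

theorem Shift.ext {x y : Shift A} (h : ∀ i, x i = y i) : x = y :=
  Subtype.ext (funext h)

theorem Shift.adj (x : Shift A) (i : ℤ) : (x i).tgt = (x (i + 1)).src := x.2 i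

theorem Shift.continuous_apply (i : ℤ) : Continuous (fun x : Shift A => x i) :=
  (_root_.continuous_apply i).comp continuous_subtype_val

instance : CompactSpace (Shift A) := by
  have hc : IsClosed {x : ℤ → Edge A | ∀ i, (x i).tgt = (x (i + 1)).src} := by
    rw [ofPred_forall]
    refine isClosed_iInter fun i => ?_
    have h : Continuous (fun x : ℤ → Edge A => (x i, x (i + 1))) := by fun_prop
    exact (isClosed_discrete {p : Edge A × Edge A | p.1.tgt = p.2.src}).preimage h
  exact isCompact_iff_compactSpace.mp hc.isCompact

end

/-- The shift map `σ_A`, `(σ_A x)_i = x_{i+1}`. -/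
def shift {k : ℕ} (A : Matrix (Fin k) (Fin k) ℕ) : Shift A ≃ₜ Shift A where
  toFun x := ⟨fun i => x (i + 1), fun i => x.adj (i + 1)⟩
  invFun x := ⟨fun i => x (i - 1), fun i => by
    have h := x.adj (i - 1)
    rwa [show i - 1 + 1 = i + 1 - 1 by ring] at h⟩
  left_inv x := Shift.ext fun i => by
    change x (i - 1 + 1) = x i
    rw [sub_add_cancel]
  right_inv x := Shift.ext fun i => by
    change x (i + 1 - 1) = x i
    rw [add_sub_cancel_right]
  continuous_toFun := Continuous.subtype_mk
    (continuous_pi fun i => Shift.continuous_apply (i + 1)) _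
  continuous_invFun := Continuous.subtype_mk
    (continuous_pi fun i => Shift.continuous_apply (i - 1)) _

/-- Automorphisms of `(X_A, σ_A)`: self-homeomorphisms commuting with the shift. -/
abbrev Aut {k : ℕ} (A : Matrix (Fin k) (Fin k) ℕ) : Type :=
  {φ : Shift A ≃ₜ Shift A // ∀ x, φ (shift A x) = shift A (φ x)}

instance {k : ℕ} (A : Matrix (Fin k) (Fin k) ℕ) :
    CoeFun (Aut A) (fun _ => Shift A → Shift A) :=
  ⟨fun φ => φ.1⟩

/-- Topological entropy of a self-map of the compact space `X_A`. -/
def htop {k : ℕ} {A : Matrix (Fin k) (Fin k) ℕ} (f : Shift A → Shift A) : EReal :=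
  Dynamics.coverEntropy f univ

/-- Irreducibility of a matrix over the nonnegative integers. -/
def Irred {k : ℕ} (A : Matrix (Fin k) (Fin k) ℕ) : Prop :=
  (A.map (Nat.cast : ℕ → ℝ)).IsIrreducible

/-! ### Rays and beams -/

section

variable {k : ℕ} {A : Matrix (Fin k) (Fin k) ℕ}

/-- The `m`-ray `R(x, m)`: the points that agree with `x` on `(-∞, m]`. -/
def ray (x : Shift A) (m : ℤ) : Set (Shift A) := {y | ∀ i ≤ m, y i = x i}

/-- An `m`-beam is a finite union of `m`-rays. -/
def IsBeamAt (m : ℤ) (U : Set (Shift A)) : Prop :=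
  ∃ s : Set (Shift A), s.Finite ∧ U = ⋃ x ∈ s, ray x m

/-- A beam is an `m`-beam for some `m`. -/
def IsBeam (U : Set (Shift A)) : Prop := ∃ m, IsBeamAt m U

/-- The `m`-rays `R(y, m)` with `y ∈ U` whose last edge `y_m` ends at the state `J`. -/
def raysEndingAt (U : Set (Shift A)) (m : ℤ) (J : Fin k) : Set (Set (Shift A)) :=
  (fun y => ray y m) '' {y ∈ U | (y m).tgt = J}

/-- The vector `v_{U,m}` of an `m`-beam `U`: its `J`-th entry is the number of the `m`-rays
that make up `U` and end at the state `J`. -/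
def beamVec (U : Set (Shift A)) (m : ℤ) (J : Fin k) : ℕ := (raysEndingAt U m J).ncard

/-- Equivalence of beams: `v_{U,m} = v_{V,m}` for some `m` for which both are `m`-beams. -/
def BeamEquiv (U V : Set (Shift A)) : Prop :=
  ∃ m, IsBeamAt m U ∧ IsBeamAt m V ∧ ∀ J, beamVec U m J = beamVec V m J

theorem self_mem_ray (x : Shift A) (m : ℤ) : x ∈ ray x m := fun _ _ => rfl

theorem ray_eq_iff {x y : Shift A} {m : ℤ} : ray x m = ray y m ↔ ∀ i ≤ m, x i = y i := by
  constructor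
  · intro h
    have : x ∈ ray y m := h ▸ self_mem_ray x m
    exact this
  · intro h
    ext z
    exact forall₂_congr fun i hi => by rw [h i hi]

theorem ray_eq_of_mem {x y : Shift A} {m : ℤ} (h : y ∈ ray x m) : ray y m = ray x m :=
  ray_eq_iff.2 h

theorem isBeamAt_iff {m : ℤ} {U : Set (Shift A)} :
    IsBeamAt m U ↔ (∀ y ∈ U, ray y m ⊆ U) ∧ ((fun y => ray y m) '' U).Finite := by
  constructor
  · rintro ⟨s, hs, rfl⟩
    refine ⟨fun y hy => ?_, ?_⟩
    · simp only [mem_iUnion] at hy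
      obtain ⟨x, hx, hy⟩ := hy
      rw [ray_eq_of_mem hy]
      exact subset_biUnion_of_mem (u := fun x => ray x m) hx
    · refine (hs.image fun y => ray y m).subset ?_
      rintro _ ⟨y, hy, rfl⟩
      simp only [mem_iUnion] at hy
      obtain ⟨x, hx, hy⟩ := hy
      exact ⟨x, hx, (ray_eq_of_mem hy).symm⟩
  · rintro ⟨h1, h2⟩
    obtain ⟨s, hsU, hs, hs'⟩ := exists_subset_image_finite_and.1 ⟨_, Subset.rfl, h2, rfl⟩
    refine ⟨s, hs, Subset.antisymm (fun y hy => ?_) (iUnion₂_subset fun x hx => h1 x (hsU hx))⟩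
    have : ray y m ∈ (fun y => ray y m) '' s := hs' ▸ mem_image_of_mem _ hy
    obtain ⟨x, hx, hxy⟩ := this
    refine mem_biUnion hx ?_
    exact ray_eq_iff.1 hxy.symm

theorem isBeam_ray (x : Shift A) (m : ℤ) : IsBeam (ray x m) :=
  ⟨m, {x}, finite_singleton x, by simp⟩

theorem IsBeamAt.mono {m n : ℤ} (h : m ≤ n) {U : Set (Shift A)} (hU : IsBeamAt m U) :
    IsBeamAt n U := by
  rw [isBeamAt_iff] at hU ⊢
  refine ⟨fun y hy => fun z hz => hU.1 y hy fun i hi => hz i (hi.trans h), ?_⟩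
  have hf : (range fun y : Shift A => fun i : Icc m n => y i).Finite := toFinite _
  refine ((hU.2.prod hf).image
    (fun p => {z : Shift A | z ∈ p.1 ∧ (fun i : Icc m n => z i) = p.2})).subset ?_
  rintro _ ⟨y, hy, rfl⟩
  refine ⟨(ray y m, fun i => y i), ⟨mem_image_of_mem _ hy, mem_range_self y⟩, ?_⟩
  ext z
  constructor
  · rintro ⟨h1, h2⟩ i hi
    rcases le_total i m with h' | h'
    · exact h1 i h'
    · exact congr_fun h2 ⟨i, h', hi⟩
  · exact fun hz => ⟨fun i hi => hz i (hi.trans h), funext fun i => hz i i.2.2⟩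

theorem IsBeamAt.union {m : ℤ} {U V : Set (Shift A)} (hU : IsBeamAt m U) (hV : IsBeamAt m V) :
    IsBeamAt m (U ∪ V) := by
  obtain ⟨s, hs, rfl⟩ := hU
  obtain ⟨t, ht, rfl⟩ := hV
  exact ⟨s ∪ t, hs.union ht, (biUnion_union _ _ _).symm⟩

theorem IsBeam.union {U V : Set (Shift A)} (hU : IsBeam U) (hV : IsBeam V) : IsBeam (U ∪ V) := by
  obtain ⟨m, hm⟩ := hU
  obtain ⟨n, hn⟩ := hV
  exact ⟨max m n, (hm.mono (le_max_left _ _)).union (hn.mono (le_max_right _ _))⟩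

theorem finite_raysEndingAt {m : ℤ} {U : Set (Shift A)} (hU : IsBeamAt m U) (J : Fin k) :
    (raysEndingAt U m J).Finite :=
  (isBeamAt_iff.1 hU).2.subset (image_mono (sep_subset _ _))

theorem beamVec_union {m : ℤ} {U V : Set (Shift A)} (hU : IsBeamAt m U) (hV : IsBeamAt m V)
    (hd : Disjoint U V) (J : Fin k) : beamVec (U ∪ V) m J = beamVec U m J + beamVec V m J := by
  unfold beamVec
  rw [← ncard_union_eq ?_ (finite_raysEndingAt hU J) (finite_raysEndingAt hV J)]
  · congr 1
    simp only [raysEndingAt, ← image_union]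
    congr 1
    ext y
    simp only [mem_ofPred_eq, mem_union]
    tauto
  · rw [Set.disjoint_left]
    rintro _ ⟨y, hy, rfl⟩ ⟨z, hz, hzy⟩
    have h : z ∈ ray y m := ray_eq_iff.1 hzy
    exact Set.disjoint_left.1 hd ((isBeamAt_iff.1 hU).1 y hy.1 h) hz.1

/-! ### Automorphisms act on rays and beams -/

/-- `φ` has coding range `r`. -/
def HasRange (φ : Shift A → Shift A) (r : ℕ) : Prop :=
  ∀ (x y : Shift A) (i : ℤ), (∀ j, i - r ≤ j → j ≤ i + r → x j = y j) → φ x i = φ y i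

theorem HasRange.mono {φ : Shift A → Shift A} {r s : ℕ} (h : HasRange φ r) (hrs : r ≤ s) :
    HasRange φ s :=
  fun x y i hxy => h x y i fun j h1 h2 => hxy j (by omega) (by omega)

theorem exists_range (φ : Shift A → Shift A) (hc : Continuous φ)
    (h : ∀ x, φ (shift A x) = shift A (φ x)) : ∃ r, HasRange φ r := by
  have hu : UniformContinuous (fun x : Shift A => φ x 0) :=
    CompactSpace.uniformContinuous_of_continuous ((Shift.continuous_apply 0).comp hc)
  have hmem : {p : Shift A × Shift A | φ p.1 0 = φ p.2 0} ∈ uniformity (Shift A) := by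
    have h1 : (SetRel.id : SetRel (Edge A) (Edge A)) ∈ uniformity (Edge A) := by
      rw [DiscreteUniformity.eq_principal_setRelId]
      exact mem_principal_self _
    exact hu h1
  obtain ⟨r, hr⟩ : ∃ r : ℕ, ∀ x y : Shift A,
      (∀ j : ℤ, -r ≤ j → j ≤ r → x j = y j) → φ x 0 = φ y 0 := by
    rw [uniformity_subtype, Pi.uniformity, comap_iInf] at hmem
    simp only [DiscreteUniformity.eq_principal_setRelId, comap_principal] at hmem
    rw [(hasBasis_iInf_principal_finite _).mem_iff] at hmem
    obtain ⟨t, ht, hsub⟩ := hmem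
    obtain ⟨r, hr⟩ : ∃ r : ℕ, ∀ j ∈ t, j.natAbs ≤ r := by
      obtain ⟨r, hr⟩ := (ht.image Int.natAbs).bddAbove
      exact ⟨r, fun j hj => hr (mem_image_of_mem _ hj)⟩
    refine ⟨r, fun x y hxy => ?_⟩
    refine hsub (show (x, y) ∈ _ from ?_)
    simp only [mem_iInter]
    intro j hj
    have := hr j hj
    exact hxy j (by omega) (by omega)
  have hz : ∀ (n : ℕ) (x y : Shift A) (i : ℤ), i.natAbs = n →
      (∀ j, i - r ≤ j → j ≤ i + r → x j = y j) → φ x i = φ y i := by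
    have h' : ∀ x, φ ((shift A).symm x) = (shift A).symm (φ x) := fun x => by
      rw [Homeomorph.eq_symm_apply, ← h, Homeomorph.apply_symm_apply]
    intro n
    induction n with
    | zero =>
      intro x y i hi hxy
      obtain rfl : i = 0 := by omega
      exact hr x y fun j h1 h2 => hxy j (by omega) (by omega)
    | succ n ih =>
      intro x y i hi hxy
      rcases lt_or_ge i 0 with h0 | h0
      · have := ih ((shift A).symm x) ((shift A).symm y) (i + 1) (by omega)
          (fun j h1 h2 => hxy (j - 1) (by omega) (by omega))
        rw [h', h'] at this
        change φ x (i + 1 - 1) = φ y (i + 1 - 1) at this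
        rwa [add_sub_cancel_right] at this
      · have := ih (shift A x) (shift A y) (i - 1) (by omega)
          (fun j h1 h2 => hxy (j + 1) (by omega) (by omega))
        rw [h, h] at this
        change φ x (i - 1 + 1) = φ y (i - 1 + 1) at this
        rwa [sub_add_cancel] at this
  exact ⟨r, fun x y i hxy => hz _ x y i rfl hxy⟩

theorem Aut.exists_range (φ : Aut A) : ∃ r, HasRange φ r ∧ HasRange φ.1.symm r := by
  obtain ⟨r, hr⟩ := SFT.exists_range φ φ.1.continuous φ.2
  obtain ⟨s, hs⟩ := SFT.exists_range φ.1.symm φ.1.symm.continuous fun x => by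
    rw [Homeomorph.symm_apply_eq, φ.2, Homeomorph.apply_symm_apply]
  exact ⟨max r s, hr.mono (le_max_left _ _), hs.mono (le_max_right _ _)⟩

theorem HasRange.agree {φ : Shift A → Shift A} {r : ℕ} (h : HasRange φ r) {x y : Shift A} {m : ℤ}
    (hxy : ∀ i ≤ m, x i = y i) : ∀ i ≤ m - r, φ x i = φ y i :=
  fun i hi => h x y i fun j _ hj => hxy j (by omega)

theorem HasRange.agree_symm {φ : Aut A} {r : ℕ} (h : HasRange φ.1.symm r) {x y : Shift A} {m : ℤ}
    (hxy : ∀ i ≤ m, φ x i = φ y i) : ∀ i ≤ m - r, x i = y i := by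
  have := h.agree hxy
  change ∀ i ≤ m - r, φ.1.symm (φ.1 x) i = φ.1.symm (φ.1 y) i at this
  simpa using this

theorem IsBeamAt.image {φ : Aut A} {r : ℕ} (h : HasRange φ r) (h' : HasRange φ.1.symm r)
    {m n : ℤ} (hn : m + r ≤ n) {U : Set (Shift A)} (hU : IsBeamAt m U) :
    IsBeamAt n (φ '' U) := by
  have hU' := isBeamAt_iff.1 (hU.mono (show m ≤ n + r by omega))
  rw [isBeamAt_iff]
  refine ⟨?_, ?_⟩
  · rintro _ ⟨y, hy, rfl⟩ z hz
    refine ⟨φ.1.symm z, (isBeamAt_iff.1 hU).1 y hy ?_, φ.1.apply_symm_apply z⟩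
    intro i hi
    refine h'.agree_symm (m := n) (fun j hj => ?_) i (by omega)
    rw [← hz j hj]
    exact congr_arg (fun w : Shift A => w j) (φ.1.apply_symm_apply z)
  · refine (hU'.2.image fun R => {z | ∃ y ∈ R, z ∈ ray (φ y) n}).subset ?_
    rintro _ ⟨_, ⟨y, hy, rfl⟩, rfl⟩
    refine ⟨_, mem_image_of_mem _ hy, ?_⟩
    ext z
    constructor
    · rintro ⟨w, hw, hz⟩ i hi
      rw [hz i hi]
      exact h.agree hw i (by omega)
    · exact fun hz => ⟨y, self_mem_ray _ _, hz⟩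

theorem IsBeam.image (φ : Aut A) {U : Set (Shift A)} (hU : IsBeam U) : IsBeam (φ '' U) := by
  obtain ⟨r, h, h'⟩ := φ.exists_range
  obtain ⟨m, hm⟩ := hU
  exact ⟨m + r, hm.image h h' le_rfl⟩

theorem ncard_image_congr {α β γ : Type*} {P : Set α} (a : α → β) (b : α → γ)
    (h : ∀ y ∈ P, ∀ z ∈ P, a y = a z ↔ b y = b z) : (a '' P).ncard = (b '' P).ncard := by
  classical
  have ha : ∀ c ∈ a '' P, ∃ y ∈ P, a y = c := fun c hc => hc
  choose g hgP hg using ha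
  refine ncard_congr (fun c hc => b (g c hc)) (fun c hc => mem_image_of_mem _ (hgP c hc)) ?_ ?_
  · intro c d hc hd hcd
    rw [← hg c hc, ← hg d hd]
    exact (h _ (hgP c hc) _ (hgP d hd)).2 hcd
  · rintro _ ⟨y, hy, rfl⟩
    have hm := mem_image_of_mem a hy
    exact ⟨a y, hm, (h _ (hgP _ hm) _ hy).1 (hg _ hm)⟩

/-- The point that follows `x` up to time `m` and `y` from then on. -/
def splice (x y : Shift A) (m : ℤ) (h : (x m).tgt = (y (m + 1)).src) : Shift A :=
  ⟨fun i => if i ≤ m then x i else y i, fun i => by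
    beta_reduce
    rcases lt_trichotomy i m with hi | rfl | hi
    · rw [if_pos hi.le, if_pos (by omega)]
      exact x.adj i
    · rw [if_pos le_rfl, if_neg (by omega)]
      exact h
    · rw [if_neg (by omega), if_neg (by omega)]
      exact y.adj i⟩

theorem splice_of_le {x y : Shift A} {m : ℤ} (h : (x m).tgt = (y (m + 1)).src) {i : ℤ}
    (hi : i ≤ m) : splice x y m h i = x i := if_pos hi

theorem splice_of_lt {x y : Shift A} {m : ℤ} (h : (x m).tgt = (y (m + 1)).src) {i : ℤ}
    (hi : m < i) : splice x y m h i = y i := if_neg (by omega)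

theorem beamVec_image_ray {φ : Aut A} {r : ℕ} (h : HasRange φ r) (h' : HasRange φ.1.symm r)
    {m N : ℤ} (hN : m + 3 * r < N) {x x' : Shift A} (hx : (x m).tgt = (x' m).tgt) (J : Fin k) :
    beamVec (φ '' ray x m) N J = beamVec (φ '' ray x' m) N J := by
  classical
  have hs : ∀ y ∈ ray x m, (x' m).tgt = (y (m + 1)).src := fun y hy => by
    rw [← hx, ← y.adj, hy m le_rfl]
  let f : Shift A → Shift A := fun y =>
    if hy : (x' m).tgt = (y (m + 1)).src then splice x' y m hy else y
  have hle : ∀ y ∈ ray x m, ∀ i ≤ m, f y i = x' i := fun y hy i hi => by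
    simp only [f, dif_pos (hs y hy)]
    exact splice_of_le _ hi
  have hlt : ∀ y ∈ ray x m, ∀ i, m < i → f y i = y i := fun y hy i hi => by
    simp only [f, dif_pos (hs y hy)]
    exact splice_of_lt _ hi
  have hfar : ∀ y ∈ ray x m, ∀ i, m + r < i → φ (f y) i = φ y i := fun y hy i hi =>
    h _ _ i fun j hj _ => hlt y hy j (by omega)
  let P : Set (Shift A) := {y ∈ ray x m | (φ y N).tgt = J}
  have e1 : raysEndingAt (φ '' ray x m) N J = (fun y => ray (φ y) N) '' P := by
    ext R
    constructor
    · rintro ⟨_, ⟨⟨y, hy, rfl⟩, hJ⟩, rfl⟩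
      exact ⟨y, ⟨hy, hJ⟩, rfl⟩
    · rintro ⟨y, ⟨hy, hJ⟩, rfl⟩
      exact ⟨φ y, ⟨⟨y, hy, rfl⟩, hJ⟩, rfl⟩
  have e2 : raysEndingAt (φ '' ray x' m) N J = (fun y => ray (φ (f y)) N) '' P := by
    ext R
    constructor
    · rintro ⟨_, ⟨⟨z, hz, rfl⟩, hJ⟩, rfl⟩
      have hxz : (x m).tgt = (z (m + 1)).src := by rw [hx, ← z.adj, hz m le_rfl]
      let y := splice x z m hxz
      have hy : y ∈ ray x m := fun i hi => splice_of_le hxz hi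
      have hyz : f y = z := Shift.ext fun i => by
        rcases le_or_gt i m with hi | hi
        · rw [hle y hy i hi, hz i hi]
        · rw [hlt y hy i hi]
          exact splice_of_lt hxz hi
      refine ⟨y, ⟨hy, ?_⟩, ?_⟩
      · rw [← hfar y hy N (by omega), hyz]
        exact hJ
      · simp only [hyz]
    · rintro ⟨y, ⟨hy, hJ⟩, rfl⟩
      refine ⟨φ (f y), ⟨⟨f y, fun i hi => hle y hy i hi, rfl⟩, ?_⟩, rfl⟩
      rw [hfar y hy N (by omega)]
      exact hJ
  unfold beamVec
  rw [e1, e2]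
  refine ncard_image_congr _ _ fun y hy z hz => ?_
  replace hy := hy.1
  replace hz := hz.1
  simp only [ray_eq_iff]
  constructor
  · intro hyz i hi
    rcases le_or_gt i (m + r) with hi' | hi'
    · have hyz' := h'.agree_symm hyz
      refine h _ _ i fun j _ hj => ?_
      rcases le_or_gt j m with hjm | hjm
      · rw [hle y hy j hjm, hle z hz j hjm]
      · rw [hlt y hy j hjm, hlt z hz j hjm]
        exact hyz' j (by omega)
    · rw [hfar y hy i hi', hfar z hz i hi']
      exact hyz i hi
  · intro hyz i hi
    rcases le_or_gt i (m + r) with hi' | hi'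
    · have hyz' := h'.agree_symm hyz
      refine h _ _ i fun j _ hj => ?_
      rcases le_or_gt j m with hjm | hjm
      · rw [hy j hjm, hz j hjm]
      · rw [← hlt y hy j hjm, ← hlt z hz j hjm]
        exact hyz' j (by omega)
    · rw [← hfar y hy i hi', ← hfar z hz i hi']
      exact hyz i hi

theorem beamVec_image_eq_sum {φ : Aut A} {m N : ℤ} {U : Set (Shift A)} (hU : IsBeamAt m U)
    (hV : IsBeamAt N (φ '' U))
    (hN : ∀ y z : Shift A, (∀ i ≤ N, φ y i = φ z i) → ∀ i ≤ m, y i = z i)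
    (c : Fin k → Fin k → ℕ)
    (hc : ∀ x ∈ U, ∀ J, beamVec (φ '' ray x m) N J = c (x m).tgt J) (J : Fin k) :
    beamVec (φ '' U) N J = ∑ I, beamVec U m I * c I J := by
  classical
  let T := (finite_raysEndingAt hV J).toFinset
  let S := fun I => (finite_raysEndingAt hU I).toFinset
  let f : Set (Shift A) → Set (Shift A) := fun R => {w | ∃ y, φ y ∈ R ∧ w ∈ ray y m}
  have hf : ∀ y, f (ray (φ y) N) = ray y m := fun y => by
    ext w
    constructor
    · rintro ⟨z, hz, hw⟩
      rw [← ray_eq_of_mem (show z ∈ ray y m from hN z y hz)]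
      exact hw
    · exact fun hw => ⟨y, self_mem_ray _ _, hw⟩
  have hmaps : ∀ R ∈ T, f R ∈ Finset.univ.biUnion S := by
    intro R hR
    simp only [T, Finite.mem_toFinset] at hR
    obtain ⟨_, ⟨⟨y, hy, rfl⟩, hJ⟩, rfl⟩ := hR
    simp only [Finset.mem_biUnion, Finset.mem_univ, true_and, S, Finite.mem_toFinset]
    refine ⟨(y m).tgt, y, ⟨hy, rfl⟩, ?_⟩
    exact (hf y).symm
  have hdisj : (↑(Finset.univ : Finset (Fin k)) : Set (Fin k)).PairwiseDisjoint S := by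
    intro I _ I' _ hne
    refine Finset.disjoint_left.2 fun R h1 h2 => hne ?_
    simp only [S, Finite.mem_toFinset] at h1 h2
    obtain ⟨y, ⟨_, hy⟩, rfl⟩ := h1
    obtain ⟨z, ⟨_, hz⟩, hzy⟩ := h2
    rw [← hy, ← hz, ray_eq_iff.1 hzy m le_rfl]
  have hfib : ∀ I, ∀ R ∈ S I, (T.filter fun Q => f Q = R).card = c I J := by
    intro I R hR
    simp only [S, Finite.mem_toFinset] at hR
    obtain ⟨x, ⟨hx, rfl⟩, rfl⟩ := hR
    rw [← hc x hx J, beamVec, ← ncard_coe_finset]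
    congr 1
    ext Q
    simp only [Finset.coe_filter, T, Finite.mem_toFinset, mem_ofPred_eq]
    constructor
    · rintro ⟨⟨_, ⟨⟨y, hy, rfl⟩, hJ⟩, rfl⟩, hQ⟩
      replace hQ : f (ray (φ y) N) = ray x m := hQ
      rw [hf] at hQ
      exact ⟨φ y, ⟨⟨y, ray_eq_iff.1 hQ, rfl⟩, hJ⟩, rfl⟩
    · rintro ⟨_, ⟨⟨y, hy, rfl⟩, hJ⟩, rfl⟩
      refine ⟨⟨φ y, ⟨⟨y, (isBeamAt_iff.1 hU).1 x hx hy, rfl⟩, hJ⟩, rfl⟩, ?_⟩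
      exact (hf y).trans (ray_eq_of_mem hy)
  have hT : beamVec (φ '' U) N J = T.card := by
    rw [beamVec, ncard_eq_toFinset_card _ (finite_raysEndingAt hV J)]
  rw [hT, Finset.card_eq_sum_card_fiberwise hmaps, Finset.sum_biUnion hdisj]
  refine Finset.sum_congr rfl fun I _ => ?_
  rw [Finset.sum_congr rfl (hfib I), Finset.sum_const, smul_eq_mul, beamVec,
    ncard_eq_toFinset_card _ (finite_raysEndingAt hU I)]

theorem BeamEquiv.image (φ : Aut A) {U V : Set (Shift A)} (h : BeamEquiv U V) :
    BeamEquiv (φ '' U) (φ '' V) := by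
  classical
  obtain ⟨m, hU, hV, hv⟩ := h
  obtain ⟨r, hr, hr'⟩ := φ.exists_range
  let N : ℤ := m + 3 * r + 1
  have hUN := hU.image hr hr' (show m + r ≤ N by omega)
  have hVN := hV.image hr hr' (show m + r ≤ N by omega)
  have hN : ∀ y z : Shift A, (∀ i ≤ N, φ y i = φ z i) → ∀ i ≤ m, y i = z i :=
    fun y z h i hi => hr'.agree_symm h i (by omega)
  let c : Fin k → Fin k → ℕ := fun I J =>
    if hI : ∃ x : Shift A, (x m).tgt = I then beamVec (φ '' ray hI.choose m) N J else 0
  have hc : ∀ x J, beamVec (φ '' ray x m) N J = c (x m).tgt J := fun x J => by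
    have hI : ∃ y : Shift A, (y m).tgt = (x m).tgt := ⟨x, rfl⟩
    simp only [c, dif_pos hI]
    exact beamVec_image_ray hr hr' (by omega) hI.choose_spec.symm J
  refine ⟨N, hUN, hVN, fun J => ?_⟩
  rw [beamVec_image_eq_sum hU hUN hN c (fun x _ => hc x),
    beamVec_image_eq_sum hV hVN hN c (fun x _ => hc x)]
  simp only [hv]

end

/-! ### The dimension group of beams -/

/-- The beams of `X_A`. -/
abbrev Beam {k : ℕ} (A : Matrix (Fin k) (Fin k) ℕ) : Type := {U : Set (Shift A) // IsBeam U}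

/-- The defining relations of `D_A`: equivalent beams have the same class, and the class of a
disjoint union is the sum of the classes. -/
def dimRels {k : ℕ} (A : Matrix (Fin k) (Fin k) ℕ) : Set (FreeAbelianGroup (Beam A)) :=
  {g | ∃ U V : Beam A, BeamEquiv U.1 V.1 ∧ g = FreeAbelianGroup.of U - FreeAbelianGroup.of V} ∪
  {g | ∃ U V W : Beam A, Disjoint U.1 V.1 ∧ W.1 = U.1 ∪ V.1 ∧
    g = FreeAbelianGroup.of W - (FreeAbelianGroup.of U + FreeAbelianGroup.of V)}

/-- Krieger's dimension group `D_A`: the group completion of the semigroup of equivalence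
classes of beams with `[U] + [V] = [U' ∪ V']` for disjoint `U' ∼ U`, `V' ∼ V`. The group
completion is given by its presentation: generators `[U]`, and the relations `dimRels`. -/
abbrev DimGroup {k : ℕ} (A : Matrix (Fin k) (Fin k) ℕ) : Type :=
  FreeAbelianGroup (Beam A) ⧸ AddSubgroup.closure (dimRels A)

section

variable {k : ℕ} {A : Matrix (Fin k) (Fin k) ℕ}

/-- The class `[U]` of a beam in `D_A`. -/
def beamClass (U : Beam A) : DimGroup A := QuotientAddGroup.mk (FreeAbelianGroup.of U)

/-- A function on beams that respects the relations induces a homomorphism on `D_A`. -/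
def dimLift {G : Type*} [AddCommGroup G] (f : Beam A → G)
    (h1 : ∀ U V : Beam A, BeamEquiv U.1 V.1 → f U = f V)
    (h2 : ∀ U V W : Beam A, Disjoint U.1 V.1 → W.1 = U.1 ∪ V.1 → f W = f U + f V) :
    DimGroup A →+ G :=
  QuotientAddGroup.lift _ (FreeAbelianGroup.lift f) <| by
    rw [AddSubgroup.closure_le]
    rintro g (⟨U, V, h, rfl⟩ | ⟨U, V, W, hd, hW, rfl⟩)
    · simp [h1 U V h]
    · simp [h2 U V W hd hW]

@[simp]
theorem dimLift_beamClass {G : Type*} [AddCommGroup G] (f : Beam A → G)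
    (h1 : ∀ U V : Beam A, BeamEquiv U.1 V.1 → f U = f V)
    (h2 : ∀ U V W : Beam A, Disjoint U.1 V.1 → W.1 = U.1 ∪ V.1 → f W = f U + f V)
    (U : Beam A) : dimLift f h1 h2 (beamClass U) = f U := by
  simp [dimLift, beamClass]

theorem beamClass_eq {U V : Beam A} (h : BeamEquiv U.1 V.1) : beamClass U = beamClass V := by
  unfold beamClass
  rw [← sub_eq_zero, ← QuotientAddGroup.mk_sub, QuotientAddGroup.eq_zero_iff]
  exact AddSubgroup.subset_closure (Or.inl ⟨U, V, h, rfl⟩)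

theorem beamClass_union {U V W : Beam A} (hd : Disjoint U.1 V.1) (hW : W.1 = U.1 ∪ V.1) :
    beamClass W = beamClass U + beamClass V := by
  unfold beamClass
  rw [← sub_eq_zero, ← QuotientAddGroup.mk_add, ← QuotientAddGroup.mk_sub,
    QuotientAddGroup.eq_zero_iff]
  exact AddSubgroup.subset_closure (Or.inr ⟨U, V, W, hd, hW, rfl⟩)

/-- The image of a beam under an automorphism. -/
def Aut.mapBeam (φ : Aut A) (U : Beam A) : Beam A := ⟨φ '' U.1, U.2.image φ⟩

/-- The endomorphism `φ_*` of `D_A` with `φ_* [U] = [φ(U)]`. -/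
def Aut.dimMap (φ : Aut A) : DimGroup A →+ DimGroup A :=
  dimLift (fun U => beamClass (φ.mapBeam U))
    (fun _ _ h => beamClass_eq (h.image φ))
    (fun U V W hd hW => beamClass_union
      ((disjoint_image_iff φ.1.injective).2 hd)
      (by change φ '' W.1 = φ '' U.1 ∪ φ '' V.1; rw [hW, image_union]))

/-- A ray, as a beam. -/
def rayBeam (x : Shift A) (m : ℤ) : Beam A := ⟨ray x m, isBeam_ray x m⟩

end

/-! ### The dimension triple of the matrix -/

/-- `A` as a matrix over `ℚ`. -/
abbrev ratMat {k : ℕ} (A : Matrix (Fin k) (Fin k) ℕ) : Matrix (Fin k) (Fin k) ℚ :=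
  A.map (Nat.cast : ℕ → ℚ)

/-- The eventual range `R(A) = ℚ^k A^k` (row vectors). -/
def eventualRange {k : ℕ} (A : Matrix (Fin k) (Fin k) ℕ) : Submodule ℚ (Fin k → ℚ) :=
  LinearMap.range (ratMat A ^ k).vecMulLinear

section

variable {k : ℕ} {A : Matrix (Fin k) (Fin k) ℕ}

theorem int_vecMul (w : Fin k → ℤ) (n : ℕ) :
    (fun i => (w i : ℚ)) ᵥ* ratMat A ^ n =
      fun i => (((w ᵥ* (A.map (Nat.cast : ℕ → ℤ)) ^ n) i : ℤ) : ℚ) := by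
  have h : ratMat A = (A.map (Nat.cast : ℕ → ℤ)).map (Int.castRingHom ℚ) := by
    ext i j
    simp
  rw [h, ← Matrix.map_pow]
  ext i
  simp [Matrix.vecMul, dotProduct]

theorem vecMul_mem_eventualRange {x : Fin k → ℚ} (hx : x ∈ eventualRange A) :
    x ᵥ* ratMat A ∈ eventualRange A := by
  obtain ⟨y, rfl⟩ := hx
  refine ⟨y ᵥ* ratMat A, ?_⟩
  simp only [Matrix.vecMulLinear_apply, Matrix.vecMul_vecMul]
  rw [← pow_succ, ← pow_succ']

theorem eq_zero_of_vecMul_eq_zero {x : Fin k → ℚ} (hx : x ∈ eventualRange A)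
    (h : x ᵥ* ratMat A = 0) : x = 0 := by
  obtain ⟨y, rfl⟩ := hx
  let f : Module.End ℚ (Fin k → ℚ) := (ratMat A).vecMulLinear
  have hf : ∀ n, f ^ n = (ratMat A ^ n).vecMulLinear := by
    intro n
    induction n with
    | zero => ext; simp
    | succ n ih =>
      refine LinearMap.ext fun z => ?_
      rw [pow_succ', Module.End.mul_apply, ih]
      simp [f, Matrix.vecMul_vecMul, pow_succ]
  have hle := Module.End.ker_pow_le_ker_pow_finrank f (k + 1)
  rw [Module.finrank_fin_fun] at hle
  have hy : y ∈ LinearMap.ker (f ^ (k + 1)) := by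
    rw [LinearMap.mem_ker, hf]
    simpa [Matrix.vecMul_vecMul, pow_succ] using h
  have := hle hy
  rwa [LinearMap.mem_ker, hf] at this

theorem exists_vecMul_eq {x : Fin k → ℚ} (hx : x ∈ eventualRange A) :
    ∃ y ∈ eventualRange A, y ᵥ* ratMat A = x := by
  let g : eventualRange A →ₗ[ℚ] eventualRange A :=
    (ratMat A).vecMulLinear.restrict fun _ => vecMul_mem_eventualRange
  have hg : Function.Injective g := by
    rw [injective_iff_map_eq_zero]
    intro a ha
    exact Subtype.ext (eq_zero_of_vecMul_eq_zero a.2 (congr_arg Subtype.val ha))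
  obtain ⟨y, hy⟩ := LinearMap.surjective_of_injective hg ⟨x, hx⟩
  exact ⟨y, y.2, congr_arg Subtype.val hy⟩

end

/-- The group `𝒢_A` of those `x ∈ R(A)` with `x A^n` integral for some `n ≥ 0`. -/
def matGroup {k : ℕ} (A : Matrix (Fin k) (Fin k) ℕ) : AddSubgroup (Fin k → ℚ) where
  carrier := {x | x ∈ eventualRange A ∧
    ∃ (n : ℕ) (w : Fin k → ℤ), x ᵥ* ratMat A ^ n = fun i => (w i : ℚ)}
  zero_mem' := ⟨zero_mem _, 0, 0, by ext; simp⟩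
  add_mem' := by
    rintro x y ⟨hx, n, w, hw⟩ ⟨hy, n', w', hw'⟩
    refine ⟨add_mem hx hy, n + n', w ᵥ* (A.map (Nat.cast : ℕ → ℤ)) ^ n' +
      w' ᵥ* (A.map (Nat.cast : ℕ → ℤ)) ^ n, ?_⟩
    rw [Matrix.add_vecMul, pow_add, ← Matrix.vecMul_vecMul, hw, int_vecMul,
      ← pow_add, add_comm n n', pow_add, ← Matrix.vecMul_vecMul, hw', int_vecMul]
    ext i
    simp
  neg_mem' := by
    rintro x ⟨hx, n, w, hw⟩
    refine ⟨neg_mem hx, n, -w, ?_⟩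
    rw [Matrix.neg_vecMul, hw]
    ext i
    simp

/-- The positive cone `𝒢_A⁺`. -/
def matPos {k : ℕ} (A : Matrix (Fin k) (Fin k) ℕ) : Set (matGroup A) :=
  {x | ∃ (n : ℕ) (w : Fin k → ℕ), (x : Fin k → ℚ) ᵥ* ratMat A ^ n = fun i => (w i : ℚ)}

/-- The endomorphism `x ↦ x A` of `𝒢_A`. -/
def matMul {k : ℕ} (A : Matrix (Fin k) (Fin k) ℕ) : matGroup A →+ matGroup A where
  toFun x := ⟨(x : Fin k → ℚ) ᵥ* ratMat A, vecMul_mem_eventualRange x.2.1, by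
    obtain ⟨n, w, hw⟩ := x.2.2
    refine ⟨n, w ᵥ* (A.map (Nat.cast : ℕ → ℤ)) ^ 1, ?_⟩
    rw [← int_vecMul, ← hw, Matrix.vecMul_vecMul, Matrix.vecMul_vecMul, pow_one,
      ← pow_succ, ← pow_succ']⟩
  map_zero' := Subtype.ext (by simp)
  map_add' x y := Subtype.ext (by simp [Matrix.add_vecMul])

theorem matMul_bijective {k : ℕ} (A : Matrix (Fin k) (Fin k) ℕ) :
    Function.Bijective (matMul A) := by
  constructor
  · rw [injective_iff_map_eq_zero]
    intro x hx
    exact Subtype.ext (eq_zero_of_vecMul_eq_zero x.2.1 (congr_arg Subtype.val hx))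
  · rintro ⟨x, hx, n, w, hw⟩
    obtain ⟨y, hy, rfl⟩ := exists_vecMul_eq hx
    refine ⟨⟨y, hy, n + 1, w, ?_⟩, rfl⟩
    rw [pow_succ', ← Matrix.vecMul_vecMul, hw]

/-- Group automorphisms of `𝒢_A`. An additive automorphism is the same as a `ℤ`-linear one; in
this form composition is written as multiplication. -/
abbrev MatAut {k : ℕ} (A : Matrix (Fin k) (Fin k) ℕ) : Type := matGroup A ≃ₗ[ℤ] matGroup A

/-- The automorphism `δ_A : x ↦ x A` of `𝒢_A`. -/
def delta {k : ℕ} (A : Matrix (Fin k) (Fin k) ℕ) : MatAut A :=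
  (AddEquiv.ofBijective (matMul A) (matMul_bijective A)).toIntLinearEquiv

/-! ### The isomorphism `θ` -/

section

variable {k : ℕ} {A : Matrix (Fin k) (Fin k) ℕ}

theorem Irred.exists_edge (hA : Irred A) (i : Fin k) : ∃ e : Edge A, e.src = i := by
  have h := (Matrix.isIrreducible_iff_exists_pow_pos
    (A := A.map (Nat.cast : ℕ → ℝ)) (fun i j => by simp)).1 hA i i
  obtain ⟨n, hn, hpos⟩ := h
  obtain ⟨n, rfl⟩ := Nat.exists_eq_succ_of_ne_zero hn.ne'
  rw [Nat.succ_eq_add_one, pow_succ', Matrix.mul_apply] at hpos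
  obtain ⟨j, -, hj⟩ := Finset.exists_ne_zero_of_sum_ne_zero hpos.ne'
  have hij : A i j ≠ 0 := fun h0 => hj (by simp [h0])
  exact ⟨⟨i, j, ⟨0, Nat.pos_of_ne_zero hij⟩⟩, rfl⟩

theorem Irred.exists_extension (hA : Irred A) (x : Shift A) (m : ℤ) (e : Edge A)
    (he : (x m).tgt = e.src) : ∃ y ∈ ray x m, y (m + 1) = e := by
  choose s hs using hA.exists_edge
  let q : ℕ → Edge A := fun n => Nat.rec e (fun _ f => s f.tgt) n
  have hq : ∀ n, (q n).tgt = (q (n + 1)).src := fun n => (hs _).symm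
  refine ⟨⟨fun i => if i ≤ m then x i else q (i - m - 1).toNat, fun i => ?_⟩,
    fun i hi => if_pos hi, ?_⟩
  · beta_reduce
    rcases lt_trichotomy i m with hi | rfl | hi
    · rw [if_pos hi.le, if_pos (by omega)]
      exact x.adj i
    · rw [if_pos le_rfl, if_neg (by omega), show (i + 1 - i - 1).toNat = 0 by omega]
      exact he
    · rw [if_neg (by omega), if_neg (by omega),
        show (i + 1 - m - 1).toNat = (i - m - 1).toNat + 1 by omega]
      exact hq _
  · change (if m + 1 ≤ m then x (m + 1) else q (m + 1 - m - 1).toNat) = e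
    rw [if_neg (by omega), show (m + 1 - m - 1).toNat = 0 by omega]
    rfl

theorem ncard_edges (I J : Fin k) : {e : Edge A | e.src = I ∧ e.tgt = J}.ncard = A I J := by
  have : {e : Edge A | e.src = I ∧ e.tgt = J} =
      range (fun a : Fin (A I J) => (⟨I, J, a⟩ : Edge A)) := by
    ext ⟨i, j, a⟩
    constructor
    · rintro ⟨rfl, rfl⟩
      exact ⟨a, rfl⟩
    · rintro ⟨b, hb⟩
      cases hb
      exact ⟨rfl, rfl⟩
  rw [this, ← image_univ, ncard_image_of_injective, ncard_univ, Nat.card_fin]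
  intro a b hab
  simpa using hab

theorem beamVec_ray_succ (hA : Irred A) (x : Shift A) (m : ℤ) (J : Fin k) :
    beamVec (ray x m) (m + 1) J = A (x m).tgt J := by
  rw [beamVec, raysEndingAt, ncard_image_congr _ (fun y : Shift A => y (m + 1)),
    ← ncard_edges (A := A)]
  · congr 1
    ext e
    constructor
    · rintro ⟨y, ⟨hy, hJ⟩, rfl⟩
      exact ⟨by rw [← y.adj, hy m le_rfl], hJ⟩
    · rintro ⟨h1, h2⟩
      obtain ⟨y, hy, rfl⟩ := hA.exists_extension x m e h1.symm
      exact ⟨y, ⟨hy, h2⟩, rfl⟩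
  · intro y hy z hz
    simp only [ray_eq_iff]
    constructor
    · exact fun h => h _ le_rfl
    · intro h i hi
      rcases le_or_gt i m with hi' | hi'
      · rw [hy.1 i hi', hz.1 i hi']
      · obtain rfl : i = m + 1 := by omega
        exact h

/-- `v_{U,m}` as a rational row vector. -/
def beamVecQ (U : Set (Shift A)) (m : ℤ) : Fin k → ℚ := fun J => (beamVec U m J : ℚ)

theorem beamVecQ_succ (hA : Irred A) {m : ℤ} {U : Set (Shift A)} (hU : IsBeamAt m U) :
    beamVecQ U (m + 1) = beamVecQ U m ᵥ* ratMat A := by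
  let φ : Aut A := ⟨Homeomorph.refl _, fun _ => rfl⟩
  have hφ : ∀ V : Set (Shift A), φ '' V = V := fun V => image_id V
  ext J
  have := beamVec_image_eq_sum (φ := φ) (N := m + 1) hU
    (by rw [hφ]; exact hU.mono (by omega)) (fun y z h i hi => h i (by omega)) A
    (fun x _ J => by rw [hφ]; exact beamVec_ray_succ hA x m J) J
  rw [hφ] at this
  simp [beamVecQ, this, Matrix.vecMul, dotProduct]

/-- The element `v_{U,m} A^k` of `𝒢_A`. -/
def beamElt (U : Set (Shift A)) (m : ℤ) : matGroup A :=
  ⟨beamVecQ U m ᵥ* ratMat A ^ k, ⟨beamVecQ U m, rfl⟩, 0,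
    (fun J => (beamVec U m J : ℤ)) ᵥ* (A.map (Nat.cast : ℕ → ℤ)) ^ k, by
      rw [← int_vecMul, pow_zero, Matrix.vecMul_one]
      simp only [Int.cast_natCast]
      rfl⟩

/-- `δ_A^{-k-n} (v_{U,n} A^k)`, for an `n`-beam `U`. -/
def thetaAt (U : Set (Shift A)) (n : ℤ) : matGroup A :=
  (delta A ^ (-(k : ℤ) - n)) (beamElt U n)

theorem thetaAt_succ (hA : Irred A) {m : ℤ} {U : Set (Shift A)} (hU : IsBeamAt m U) :
    thetaAt U (m + 1) = thetaAt U m := by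
  have h : beamElt U (m + 1) = delta A (beamElt U m) := by
    refine Subtype.ext ?_
    change beamVecQ U (m + 1) ᵥ* ratMat A ^ k = (beamVecQ U m ᵥ* ratMat A ^ k) ᵥ* ratMat A
    rw [beamVecQ_succ hA hU, Matrix.vecMul_vecMul, Matrix.vecMul_vecMul, ← pow_succ, ← pow_succ']
  unfold thetaAt
  rw [h, ← LinearEquiv.mul_apply, ← zpow_add_one]
  congr 2
  ring

theorem thetaAt_eq (hA : Irred A) {m n : ℤ} {U : Set (Shift A)} (hU : IsBeamAt m U)
    (h : m ≤ n) : thetaAt U n = thetaAt U m := by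
  induction n, h using Int.leInduction with
  | base => rfl
  | succ n hn ih => rw [thetaAt_succ hA (hU.mono hn), ih]

theorem thetaAt_choose (hA : Irred A) (U : Beam A) {n : ℤ} (h : IsBeamAt n U.1) :
    thetaAt U.1 U.2.choose = thetaAt U.1 n := by
  rw [← thetaAt_eq hA U.2.choose_spec (le_max_left _ n), thetaAt_eq hA h (le_max_right _ n)]

/-- The homomorphism `θ : D_A → 𝒢_A` with `θ [U] = δ_A^{-k-n} (v_{U,n} A^k)` for every
`n`-beam `U`. -/
def theta (hA : Irred A) : DimGroup A →+ matGroup A :=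
  dimLift (fun U => thetaAt U.1 U.2.choose)
    (fun U V h => by
      obtain ⟨m, hU, hV, hv⟩ := h
      rw [thetaAt_choose hA U hU, thetaAt_choose hA V hV]
      have : beamVecQ U.1 m = beamVecQ V.1 m := funext fun J => by simp [beamVecQ, hv J]
      simp only [thetaAt, beamElt, this])
    (fun U V W hd hW => by
      obtain ⟨m, hU⟩ := U.2
      obtain ⟨n, hV⟩ := V.2
      replace hU := hU.mono (le_max_left m n)
      replace hV := hV.mono (le_max_right m n)
      have hW' : IsBeamAt (max m n) W.1 := hW ▸ hU.union hV
      rw [thetaAt_choose hA U hU, thetaAt_choose hA V hV, thetaAt_choose hA W hW']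
      unfold thetaAt
      rw [← map_add]
      congr 1
      refine Subtype.ext ?_
      change beamVecQ W.1 _ ᵥ* ratMat A ^ k =
        beamVecQ U.1 _ ᵥ* ratMat A ^ k + beamVecQ V.1 _ ᵥ* ratMat A ^ k
      rw [← Matrix.add_vecMul]
      congr 1
      ext J
      simp [beamVecQ, hW, beamVec_union hU hV hd J])

theorem theta_beamClass (hA : Irred A) (U : Beam A) {n : ℤ} (h : IsBeamAt n U.1) :
    theta hA (beamClass U) = (delta A ^ (-(k : ℤ) - n)) (beamElt U.1 n) := by
  rw [theta, dimLift_beamClass, thetaAt_choose hA U h, thetaAt]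

/-- `S` is the automorphism `S_φ` of the triple `(𝒢_A, 𝒢_A⁺, δ_A)` that corresponds to `φ_*`
under `θ`. -/
structure IsDimRep (hA : Irred A) (φ : Aut A) (S : MatAut A) : Prop where
  /-- the square formed by `θ`, `φ_*` and `S` commutes -/
  comm : ∀ d, S (theta hA d) = theta hA (φ.dimMap d)
  /-- `S` maps the positive cone onto itself -/
  pos : ∀ g, S g ∈ matPos A ↔ g ∈ matPos A
  /-- `S` commutes with `δ_A` -/
  comm_delta : ∀ g, S (delta A g) = delta A (S g)

/-- The complexification `S ⊗ 1` of an automorphism of `𝒢_A`. -/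
def complexify (S : MatAut A) : (ℂ ⊗[ℤ] matGroup A) →ₗ[ℂ] (ℂ ⊗[ℤ] matGroup A) :=
  S.toLinearMap.baseChange ℂ

end

/-! ### Measures on unstable sets -/

/-- The Perron–Frobenius eigenvalue `λ_A`: the spectral radius of `A`. -/
def perron {k : ℕ} (A : Matrix (Fin k) (Fin k) ℕ) : ℝ :=
  (spectralRadius ℂ (A.map (Nat.cast : ℕ → ℂ))).toReal

section

variable {k : ℕ} {A : Matrix (Fin k) (Fin k) ℕ}

/-- The unstable set `W^u(x) = ⋃ₙ R(x, n)`. -/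
structure Unstable (x : Shift A) where
  /-- the underlying point of `X_A` -/
  pt : Shift A
  mem : pt ∈ ⋃ n : ℤ, ray x n

/-- The part of `W^u(x)` in the ray `R(y, m)` (this is all of `R(y, m)` if `y ∈ W^u(x)`). -/
def unstableRay (x y : Shift A) (m : ℤ) : Set (Unstable x) := {z | z.pt ∈ ray y m}

/-- The topology on `W^u(x)` with basis the rays `R(y, m)`, `y ∈ W^u(x)`. -/
instance (x : Shift A) : TopologicalSpace (Unstable x) :=
  TopologicalSpace.generateFrom {U | ∃ (y : Unstable x) (m : ℤ), U = unstableRay x y.pt m}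

instance (x : Shift A) : MeasurableSpace (Unstable x) := borel _

instance (x : Shift A) : BorelSpace (Unstable x) := ⟨rfl⟩

/-- The map `W^u(x) → W^u(φ(x))` induced by an automorphism `φ`. -/
def Aut.unstableMap (φ : Aut A) (x : Shift A) (y : Unstable x) : Unstable (φ x) :=
  ⟨φ y.pt, by
    obtain ⟨r, hr, -⟩ := φ.exists_range
    obtain ⟨n, hn⟩ := mem_iUnion.1 y.mem
    exact mem_iUnion.2 ⟨n - r, hr.agree hn⟩⟩

/-- The family `μ` of Borel measures on the unstable sets is the one given by some positive
right eigenvector `v_r` of `A` for `λ_A`, i.e. `μ^x(R(y, m)) = λ_A^{-m} v_r(t(y_m))`. -/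
def IsUnstableMeasureFamily (μ : ∀ x : Shift A, Measure (Unstable x)) : Prop :=
  ∃ v : Fin k → ℝ, (∀ i, 0 < v i) ∧ A.map (Nat.cast : ℕ → ℝ) *ᵥ v = perron A • v ∧
    ∀ (x : Shift A) (y : Unstable x) (m : ℤ),
      μ x (unstableRay x y.pt m) = ENNReal.ofReal (perron A ^ (-m) * v (y.pt m).tgt)

/-- `τ` is the state on `D_A` that corresponds to the family `μ`:
a homomorphism, nonnegative on the classes of beams, with `τ [R(x, n)] = μ^x(R(x, n))`. -/
structure IsState (μ : ∀ x : Shift A, Measure (Unstable x)) (τ : DimGroup A →+ ℝ) : Prop where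
  nonneg : ∀ U : Beam A, 0 ≤ τ (beamClass U)
  ray : ∀ (x : Shift A) (n : ℤ), τ (beamClass (rayBeam x n)) = (μ x (unstableRay x x n)).toReal

/-- `φ` multiplies the canonical measures on unstable sets by `c`:
`μ^{φ(x)}(φ(S)) = c μ^x(S)` for every point `x` and every Borel set `S ⊆ W^u(x)`. -/
def ScalesMeasures (φ : Aut A) (c : ℝ) : Prop :=
  ∀ μ : ∀ x : Shift A, Measure (Unstable x), IsUnstableMeasureFamily μ →
    ∀ (x : Shift A) (S : Set (Unstable x)), MeasurableSet S →
      μ (φ x) (φ.unstableMap x '' S) = ENNReal.ofReal c * μ x S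

/-- `φ_*` multiplies the canonical states on `D_A` by `c`. -/
def ScalesState (φ : Aut A) (c : ℝ) : Prop :=
  ∀ (μ : ∀ x : Shift A, Measure (Unstable x)) (τ : DimGroup A →+ ℝ),
    IsUnstableMeasureFamily μ → IsState μ τ → ∀ d, τ (φ.dimMap d) = c * τ d

/-- `S_φ ⊗ 1` acts on the `λ_A`-eigenspace of `δ_A ⊗ 1` as multiplication by `c`. -/
def IsPerronEigenvalue (hA : Irred A) (φ : Aut A) (c : ℂ) : Prop :=
  ∀ S : MatAut A, IsDimRep hA φ S → ∀ v : ℂ ⊗[ℤ] matGroup A,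
    complexify (delta A) v = (perron A : ℂ) • v → complexify S v = c • v

end

end SFT

end

/-! ### Perron–Frobenius theory of irreducible matrices -/

namespace Matrix

variable {n : Type*} [Fintype n] {B : Matrix n n ℝ}

/-! Everything is read off one nonnegative integer matrix `C`. Since `φ` and its inverse have finite
coding range, the number of `(m + l)`-rays of `φ(R(x, m))` ending at a state `J` depends only on the
terminal state of `x_m`, and by shift invariance not on `m`. These numbers form the transition
matrix `C` (`exists_isTransition`). Counting rays of `φ(R(x, m))` one step later in two ways shows
that `C` commutes with `A`.

On `𝒢_A` the action of `φ_*` is therefore `x ↦ δ_A^{-l}(x C)`. As `θ` is onto, this formula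
determines `S_φ`, and the same construction for `φ⁻¹` inverts it; injectivity of `θ` plays no role.
A right Perron vector `v` pairs with `𝒢_A`, and composing with `θ` gives the state (`perronState`).
The `λ_A`-eigenspace of the irreducible matrix `A` is a line, which `C` preserves, so `C v = c λ_A^l
v` and the state is multiplied by `c`. The factor for `φ⁻¹` is its inverse, hence `c > 0`.

Beams in `W^u(x)` are compact, open and form a ring generating the Borel sets. So the state extends
to a measure, and the scaling of measures follows from the scaling of states. On the other side,
`𝒢_A ⊗ ℂ` embeds in `ℂ^k`, where the `λ_A`-eigenspace is spanned by a left Perron vector `u`.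
Evaluating `u C v` in two ways shows that `u` has the same factor as `v`.

For the entropy, let `φ` have range `r`. Points of one ray whose orbits stay close on `[-r, r]` up
to time `n` have images under `φ^n` in a common `r`-ray. If `N` dynamical balls cover, then
`φ^n(R(x, 0))` lies in at most `N` rays of bounded state, while its state is `c^n` times a positive
constant. So `log c` is at most the entropy; the inverse, whose entropy is no larger, gives the
bound for `-log c`. -/

theorem mulVec_pos {P : Matrix n n ℝ} (hP : ∀ i j, 0 < P i j) {v : n → ℝ} (hv : ∀ i, 0 ≤ v i)
    (hv0 : v ≠ 0) (i : n) : 0 < (P *ᵥ v) i := by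
  obtain ⟨j, hj⟩ := Function.ne_iff.1 hv0
  exact Finset.sum_pos' (fun l _ => mul_nonneg (hP i l).le (hv l))
    ⟨j, Finset.mem_univ _, mul_pos (hP i j) (lt_of_le_of_ne (hv j) (Ne.symm hj))⟩

/-- Both eigenvalues multiply the positive number `u ⬝ᵥ v` to give `u B v`. -/
theorem eigenvalue_eq_of_pos {u v : n → ℝ} {r s : ℝ} [Nonempty n] (hu : ∀ i, 0 < u i)
    (hv : ∀ i, 0 < v i) (hul : u ᵥ* B = s • u) (hvr : B *ᵥ v = r • v) : s = r := by
  have h := dotProduct_mulVec u B v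
  rw [hul, hvr, dotProduct_smul, smul_dotProduct] at h
  have hp : 0 < u ⬝ᵥ v := Finset.sum_pos (fun i _ => mul_pos (hu i) (hv i)) Finset.univ_nonempty
  exact (mul_right_cancel₀ hp.ne' h).symm

variable [DecidableEq n]

theorem pow_mulVec_eq_smul {R : Type*} [CommSemiring R] {B : Matrix n n R} {v : n → R} {r : R}
    (h : B *ᵥ v = r • v) (m : ℕ) : B ^ m *ᵥ v = r ^ m • v := by
  induction m with
  | zero => simp
  | succ m ih => rw [pow_succ, ← mulVec_mulVec, h, mulVec_smul, ih, smul_smul, pow_succ']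

/-- Some sum of powers of an irreducible matrix is entrywise positive. -/
theorem IsIrreducible.exists_sum_pow_pos (hB : B.IsIrreducible) :
    ∃ M : ℕ, ∀ i j, 0 < (∑ m ∈ Finset.range M, B ^ m) i j := by
  choose p hp0 hp using (isIrreducible_iff_exists_pow_pos hB.nonneg).1 hB
  obtain ⟨M, hM⟩ : ∃ M, ∀ i j, p i j < M := by
    obtain ⟨M, hM⟩ := (Set.finite_range fun q : n × n => p q.1 q.2).bddAbove
    exact ⟨M + 1, fun i j => Nat.lt_succ_of_le (hM ⟨(i, j), rfl⟩)⟩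
  refine ⟨M, fun i j => ?_⟩
  rw [sum_apply]
  exact Finset.sum_pos' (fun m _ => pow_apply_nonneg hB.nonneg m i j)
    ⟨p i j, Finset.mem_range.2 (hM i j), hp i j⟩

/-- A positive sum of powers of `B` sends `v` to a strictly positive vector, which is also a
multiple of `v`; so no entry of `v` can vanish. -/
theorem IsIrreducible.pos_of_mulVec_eq_smul (hB : B.IsIrreducible) {v : n → ℝ} {r : ℝ}
    (hv : ∀ i, 0 ≤ v i) (hv0 : v ≠ 0) (h : B *ᵥ v = r • v) (i : n) : 0 < v i := by
  obtain ⟨M, hM⟩ := hB.exists_sum_pow_pos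
  have h1 := mulVec_pos hM hv hv0 i
  have h2 : (∑ m ∈ Finset.range M, B ^ m) *ᵥ v = (∑ m ∈ Finset.range M, r ^ m) • v := by
    rw [sum_mulVec, Finset.sum_smul]
    exact Finset.sum_congr rfl fun m _ => pow_mulVec_eq_smul h m
  rw [h2] at h1
  refine lt_of_le_of_ne (hv i) fun h0 => ?_
  simp [← h0] at h1

/-- An irreducible nonnegative matrix has a positive eigenvector. -/
theorem IsIrreducible.exists_pos_eigenvector [Nonempty n] (hB : B.IsIrreducible) :
    ∃ (r : ℝ) (v : n → ℝ), 0 ≤ r ∧ (∀ i, 0 < v i) ∧ B *ᵥ v = r • v := by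
  classical
  let c : ℝ := ∑ i, ∑ j, B i j
  -- Collatz–Wielandt: the eigenvalue is the largest `t` with `t x ≤ B x` for some `x` in the
  -- simplex. Summing entries bounds `t` by `c`, which makes the set of such pairs compact.
  let K : Set (ℝ × (n → ℝ)) := (Icc 0 c ×ˢ stdSimplex ℝ n) ∩ {p | ∀ i, p.1 * p.2 i ≤ (B *ᵥ p.2) i}
  have hbd : ∀ (t : ℝ), ∀ x ∈ stdSimplex ℝ n, (∀ i, t * x i ≤ (B *ᵥ x) i) → t ≤ c := by
    intro t x hx h
    calc t = ∑ i, t * x i := by rw [← Finset.mul_sum, hx.2, mul_one]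
      _ ≤ ∑ i, (B *ᵥ x) i := Finset.sum_le_sum fun i _ => h i
      _ ≤ c := Finset.sum_le_sum fun i _ => Finset.sum_le_sum fun j _ => by
        have h1 : x j ≤ 1 := by
          rw [← hx.2]
          exact Finset.single_le_sum (fun l _ => hx.1 l) (Finset.mem_univ j)
        exact mul_le_of_le_one_right (hB.nonneg i j) h1
  have hK : IsCompact K := by
    refine (isCompact_Icc.prod (isCompact_stdSimplex ℝ n)).inter_right ?_
    rw [ofPred_forall]
    refine isClosed_iInter fun i => isClosed_le (by fun_prop) ?_
    have : Continuous fun p : ℝ × (n → ℝ) => B *ᵥ p.2 := continuous_const.matrix_mulVec continuous_snd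
    exact (continuous_apply i).comp this
  have hne : K.Nonempty := by
    obtain ⟨i⟩ := ‹Nonempty n›
    refine ⟨(0, Pi.single i 1), ⟨⟨le_rfl, ?_⟩, single_mem_stdSimplex ℝ i⟩, fun j => ?_⟩
    · exact Finset.sum_nonneg fun i _ => Finset.sum_nonneg fun j _ => hB.nonneg i j
    · simpa using hB.nonneg j i
  obtain ⟨⟨t, x⟩, ⟨⟨ht, hx⟩, htx⟩, hmax⟩ := hK.exists_isMaxOn hne continuous_fst.continuousOn
  have hx0 : x ≠ 0 := by
    rintro rfl
    simpa using hx.2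
  have hz0 : ∀ i, 0 ≤ (B *ᵥ x - t • x) i := fun i => by simpa using htx i
  have heq : B *ᵥ x = t • x := by
    -- If `B x - t x` is nonzero, applying the positive matrix `P` makes the inequality strict in
    -- every entry, and then `t` is not maximal.
    by_contra hne
    obtain ⟨M, hM⟩ := hB.exists_sum_pow_pos
    set P := ∑ m ∈ Finset.range M, B ^ m with hP
    have hcomm : B * P = P * B := by
      rw [hP, Finset.mul_sum, Finset.sum_mul]
      exact Finset.sum_congr rfl fun m _ => (Commute.self_pow B m).eq
    have hy := mulVec_pos hM hx.1 hx0
    have hw := mulVec_pos hM hz0 (sub_ne_zero.2 hne)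
    have hBy : B *ᵥ (P *ᵥ x) = t • (P *ᵥ x) + P *ᵥ (B *ᵥ x - t • x) := by
      rw [mulVec_sub, mulVec_smul, mulVec_mulVec, mulVec_mulVec, hcomm]
      abel
    set y := P *ᵥ x
    set w := P *ᵥ (B *ᵥ x - t • x)
    -- The least ratio is the largest amount by which `t` can be raised for the vector `y`.
    obtain ⟨i₀, hi₀⟩ := Finite.exists_min (fun i => w i / y i)
    set ε := w i₀ / y i₀
    have hε : 0 < ε := div_pos (hw i₀) (hy i₀)
    have hεy : ∀ i, ε * y i ≤ w i := fun i => (le_div_iff₀ (hy i)).1 (hi₀ i)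
    have hs : 0 < ∑ i, y i := Finset.sum_pos (fun i _ => hy i) Finset.univ_nonempty
    have hyK : (∑ i, y i)⁻¹ • y ∈ stdSimplex ℝ n :=
      ⟨fun i => mul_nonneg (inv_nonneg.2 hs.le) (hy i).le, by
        simp only [Pi.smul_apply, smul_eq_mul]
        rw [← Finset.mul_sum, inv_mul_cancel₀ hs.ne']⟩
    have hle : ∀ i, (t + ε) * ((∑ i, y i)⁻¹ • y) i ≤ (B *ᵥ ((∑ i, y i)⁻¹ • y)) i := by
      intro i
      rw [mulVec_smul, hBy]
      simp only [Pi.smul_apply, Pi.add_apply, smul_eq_mul]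
      have := mul_le_mul_of_nonneg_left (hεy i) (inv_nonneg.2 hs.le)
      nlinarith
    have := hmax (show ((t + ε, (∑ i, y i)⁻¹ • y) : ℝ × (n → ℝ)) ∈ K from
      ⟨⟨⟨add_nonneg ht.1 hε.le, hbd _ _ hyK hle⟩, hyK⟩, hle⟩)
    have : t + ε ≤ t := this
    linarith
  exact ⟨t, x, ht.1, hB.pos_of_mulVec_eq_smul hx.1 hx0 heq, heq⟩

/-- A real eigenvector for the eigenvalue of a positive eigenvector is a multiple of it. -/
theorem IsIrreducible.eigenvector_unique [Nonempty n] (hB : B.IsIrreducible) {v w : n → ℝ} {r : ℝ}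
    (hv : ∀ i, 0 < v i) (h : B *ᵥ v = r • v) (hw : B *ᵥ w = r • w) : ∃ t : ℝ, w = t • v := by
  -- Subtracting the least ratio times `v` leaves a nonnegative eigenvector that vanishes at `i`,
  -- hence is zero.
  obtain ⟨i, hi⟩ := Finite.exists_min (fun i => w i / v i)
  refine ⟨w i / v i, ?_⟩
  by_contra hne
  have hpos := hB.pos_of_mulVec_eq_smul (v := w - (w i / v i) • v) (r := r)
    (fun j => by
      have := (le_div_iff₀ (hv j)).1 (hi j)
      simpa using this)
    (sub_ne_zero.2 hne) (by rw [mulVec_sub, mulVec_smul, h, hw, smul_sub, smul_comm]) i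
  simp [div_mul_cancel₀ _ (hv i).ne'] at hpos

/-- The eigenvalue of a positive eigenvector is the spectral radius. -/
theorem IsIrreducible.spectralRadius_eq [Nonempty n] (hB : B.IsIrreducible) {v : n → ℝ} {r : ℝ}
    (hr : 0 ≤ r) (hv : ∀ i, 0 < v i) (h : B *ᵥ v = r • v) :
    spectralRadius ℂ (B.map ((↑) : ℝ → ℂ)) = ENNReal.ofReal r := by
  obtain ⟨s, u, hs, hu, hul⟩ := hB.transpose.exists_pos_eigenvector
  rw [mulVec_transpose] at hul
  obtain rfl := eigenvalue_eq_of_pos hu hv hul h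
  refine le_antisymm (iSup₂_le fun z hz => ?_) ?_
  · rw [← spectrum_toLin', ← Module.End.hasEigenvalue_iff_mem_spectrum] at hz
    obtain ⟨w, hw⟩ := hz.exists_hasEigenvector
    have hw0 := hw.2
    have hw1 : B.map ((↑) : ℝ → ℂ) *ᵥ w = z • w := by
      simpa using hw.apply_eq_smul
    -- The triangle inequality in `B w = z w`; pairing with the positive left eigenvector `u` then
    -- gives `‖z‖ ≤ s`.
    have hle : ∀ i, ‖z‖ * ‖w i‖ ≤ (B *ᵥ fun j => ‖w j‖) i := fun i => by
      rw [← norm_mul, show z * w i = (B.map ((↑) : ℝ → ℂ) *ᵥ w) i by rw [hw1]; rfl]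
      refine (norm_sum_le _ _).trans (Finset.sum_le_sum fun j _ => ?_)
      simp [abs_of_nonneg (hB.nonneg i j)]
    have hpos : 0 < u ⬝ᵥ fun j => ‖w j‖ := by
      obtain ⟨j, hj⟩ := Function.ne_iff.1 hw0
      exact Finset.sum_pos' (fun i _ => mul_nonneg (hu i).le (norm_nonneg _))
        ⟨j, Finset.mem_univ _, mul_pos (hu j) (norm_pos_iff.2 hj)⟩
    have hfin : ‖z‖ * (u ⬝ᵥ fun j => ‖w j‖) ≤ s * (u ⬝ᵥ fun j => ‖w j‖) := by
      calc ‖z‖ * (u ⬝ᵥ fun j => ‖w j‖) = ∑ i, u i * (‖z‖ * ‖w i‖) := by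
            rw [dotProduct, Finset.mul_sum]
            exact Finset.sum_congr rfl fun i _ => by ring
        _ ≤ u ⬝ᵥ (B *ᵥ fun j => ‖w j‖) :=
            Finset.sum_le_sum fun i _ => mul_le_mul_of_nonneg_left (hle i) (hu i).le
        _ = s * (u ⬝ᵥ fun j => ‖w j‖) := by
            rw [dotProduct_mulVec, hul, smul_dotProduct, smul_eq_mul]
    rw [← enorm_eq_nnnorm, ← ofReal_norm]
    exact ENNReal.ofReal_le_ofReal (le_of_mul_le_mul_right hfin hpos)
  · have hz : (s : ℂ) ∈ spectrum ℂ (B.map ((↑) : ℝ → ℂ)) := by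
      rw [← spectrum_toLin', ← Module.End.hasEigenvalue_iff_mem_spectrum]
      refine Module.End.hasEigenvalue_of_hasEigenvector (x := fun i => (v i : ℂ)) ⟨?_, ?_⟩
      · rw [Module.End.mem_eigenspace_iff, toLin'_apply]
        ext i
        have := congr_arg ((↑) : ℝ → ℂ) (congr_fun h i)
        simpa [mulVec, dotProduct] using this
      · obtain ⟨i⟩ := ‹Nonempty n›
        exact fun h0 => (hv i).ne' (by simpa using congr_fun h0 i)
    refine le_trans ?_ (le_iSup₂ (f := fun z (_ : z ∈ spectrum ℂ (B.map ((↑) : ℝ → ℂ))) =>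
      (‖z‖₊ : ENNReal)) (s : ℂ) hz)
    rw [← enorm_eq_nnnorm, ← ofReal_norm, Complex.norm_real, Real.norm_of_nonneg hs]

end Matrix

/-! ### Perron eigenvectors of the matrix of the graph -/

namespace SFT

variable {k : ℕ} {A : Matrix (Fin k) (Fin k) ℕ}

theorem perron_eq [Nonempty (Fin k)] (hA : Irred A) {v : Fin k → ℝ} {r : ℝ} (hr : 0 ≤ r)
    (hv : ∀ i, 0 < v i) (h : A.map (Nat.cast : ℕ → ℝ) *ᵥ v = r • v) : perron A = r := by
  have := Matrix.IsIrreducible.spectralRadius_eq hA hr hv h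
  rw [perron, ← ENNReal.toReal_ofReal hr, ← this]
  congr 2

theorem Irred.exists_right_eigenvector [Nonempty (Fin k)] (hA : Irred A) :
    ∃ v : Fin k → ℝ, (∀ i, 0 < v i) ∧ A.map (Nat.cast : ℕ → ℝ) *ᵥ v = perron A • v := by
  obtain ⟨r, v, hr, hv, h⟩ := Matrix.IsIrreducible.exists_pos_eigenvector hA
  exact ⟨v, hv, by rw [perron_eq hA hr hv h, h]⟩

theorem Irred.exists_left_eigenvector [Nonempty (Fin k)] (hA : Irred A) :
    ∃ u : Fin k → ℝ, (∀ i, 0 < u i) ∧ u ᵥ* A.map (Nat.cast : ℕ → ℝ) = perron A • u := by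
  obtain ⟨v, hv, h⟩ := hA.exists_right_eigenvector
  obtain ⟨r, u, hr, hu, h'⟩ :=
    Matrix.IsIrreducible.exists_pos_eigenvector (Matrix.IsIrreducible.transpose hA)
  rw [Matrix.mulVec_transpose] at h'
  exact ⟨u, hu, by rw [h', Matrix.eigenvalue_eq_of_pos hu hv h' h]⟩

theorem Irred.perron_pos [Nonempty (Fin k)] (hA : Irred A) : 0 < perron A := by
  obtain ⟨v, hv, h⟩ := hA.exists_right_eigenvector
  obtain ⟨i⟩ := ‹Nonempty (Fin k)›
  obtain ⟨e, rfl⟩ := hA.exists_edge i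
  have h1 : 0 < (A.map (Nat.cast : ℕ → ℝ) *ᵥ v) e.src :=
    Finset.sum_pos' (fun j _ => mul_nonneg (by simp) (hv j).le)
      ⟨e.tgt, Finset.mem_univ _, mul_pos (by simpa using e.idx.pos) (hv _)⟩
  rw [h] at h1
  exact pos_of_mul_pos_left h1 (hv _).le

/-- Complex left eigenvectors for `λ_A` are multiples of a positive one. -/
theorem Irred.left_eigenvector_unique [Nonempty (Fin k)] (hA : Irred A) {u : Fin k → ℝ}
    (hu : ∀ i, 0 < u i) (h : u ᵥ* A.map (Nat.cast : ℕ → ℝ) = perron A • u) {w : Fin k → ℂ}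
    (hw : w ᵥ* A.map (Nat.cast : ℕ → ℂ) = (perron A : ℂ) • w) :
    ∃ t : ℂ, w = t • fun i => (u i : ℂ) := by
  have hB := Matrix.IsIrreducible.transpose hA
  rw [← Matrix.mulVec_transpose] at h
  -- Matrix and eigenvalue are real, so real and imaginary parts are eigenvectors separately.
  have hre : (A.map (Nat.cast : ℕ → ℝ))ᵀ *ᵥ (fun i => (w i).re) = perron A • fun i => (w i).re := by
    rw [Matrix.mulVec_transpose]
    ext i
    have := congr_arg Complex.re (congr_fun hw i)
    simpa [Matrix.vecMul, dotProduct] using this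
  have him : (A.map (Nat.cast : ℕ → ℝ))ᵀ *ᵥ (fun i => (w i).im) = perron A • fun i => (w i).im := by
    rw [Matrix.mulVec_transpose]
    ext i
    have := congr_arg Complex.im (congr_fun hw i)
    simpa [Matrix.vecMul, dotProduct] using this
  obtain ⟨a, ha⟩ := hB.eigenvector_unique hu h hre
  obtain ⟨b, hb⟩ := hB.eigenvector_unique hu h him
  refine ⟨⟨a, b⟩, funext fun i => Complex.ext ?_ ?_⟩
  · simpa using congr_fun ha i
  · simpa using congr_fun hb i

end SFT

namespace SFT

variable {k : ℕ} {A : Matrix (Fin k) (Fin k) ℕ}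

/-! ### Points and beams of the edge shift -/

theorem Irred.exists_edge_tgt (hA : Irred A) (j : Fin k) : ∃ e : Edge A, e.tgt = j := by
  obtain ⟨n, hn, hpos⟩ := (Matrix.isIrreducible_iff_exists_pow_pos
    (A := A.map (Nat.cast : ℕ → ℝ)) (fun i j => by simp)).1 hA j j
  obtain ⟨n, rfl⟩ := Nat.exists_eq_succ_of_ne_zero hn.ne'
  rw [Nat.succ_eq_add_one, pow_succ, Matrix.mul_apply] at hpos
  obtain ⟨i, -, hi⟩ := Finset.exists_ne_zero_of_sum_ne_zero hpos.ne'
  have hij : A i j ≠ 0 := fun h0 => hi (by simp [h0])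
  exact ⟨⟨i, j, ⟨0, Nat.pos_of_ne_zero hij⟩⟩, rfl⟩

/-- Every state is visited at every time by some point. -/
theorem Irred.exists_point (hA : Irred A) (m : ℤ) (J : Fin k) :
    ∃ x : Shift A, (x m).tgt = J := by
  choose s hs using hA.exists_edge
  choose p hp using hA.exists_edge_tgt
  let q : ℕ → Edge A := fun n => Nat.rec (s J) (fun _ f => s f.tgt) n
  let q' : ℕ → Edge A := fun n => Nat.rec (p J) (fun _ f => p f.src) n
  have hq : ∀ n, (q n).tgt = (q (n + 1)).src := fun n => (hs _).symm
  have hq' : ∀ n, (q' (n + 1)).tgt = (q' n).src := fun n => hp _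
  refine ⟨⟨fun i => if i ≤ m then q' (m - i).toNat else q (i - m - 1).toNat, fun i => ?_⟩, ?_⟩
  · beta_reduce
    rcases lt_trichotomy i m with hi | rfl | hi
    · rw [if_pos hi.le, if_pos (by omega), show (m - i).toNat = (m - (i + 1)).toNat + 1 by omega]
      exact hq' _
    · rw [if_pos le_rfl, if_neg (by omega), show (i + 1 - i - 1).toNat = 0 by omega, sub_self]
      exact (hp J).trans (hs J).symm
    · rw [if_neg (by omega), if_neg (by omega),
        show (i + 1 - m - 1).toNat = (i - m - 1).toNat + 1 by omega]
      exact hq _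
  · change (if m ≤ m then q' (m - m).toNat else _).tgt = J
    rw [if_pos le_rfl, sub_self]
    exact hp J

theorem isBeamAt_ray (x : Shift A) (m : ℤ) : IsBeamAt m (ray x m) :=
  ⟨{x}, finite_singleton x, by simp⟩

theorem beamVec_ray (x : Shift A) (m : ℤ) : beamVec (ray x m) m = Pi.single (x m).tgt 1 := by
  ext J
  have h : ∀ y ∈ ray x m, ray y m = ray x m := fun y => ray_eq_of_mem
  rcases eq_or_ne J (x m).tgt with rfl | hJ
  · rw [Pi.single_eq_same, beamVec, ncard_eq_one]
    refine ⟨ray x m, Subset.antisymm ?_ ?_⟩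
    · rintro _ ⟨y, hy, rfl⟩
      exact h y hy.1
    · rintro _ rfl
      exact ⟨x, ⟨self_mem_ray x m, rfl⟩, rfl⟩
  · rw [Pi.single_eq_of_ne hJ, beamVec,
      eq_empty_of_forall_notMem (s := raysEndingAt (ray x m) m J) ?_, ncard_empty]
    rintro _ ⟨y, ⟨hy, hyJ⟩, rfl⟩
    exact hJ (by rw [← hyJ, hy m le_rfl])

theorem beamVecQ_ray (x : Shift A) (m : ℤ) :
    beamVecQ (ray x m) m = Pi.single (x m).tgt 1 := by
  ext J
  simp [beamVecQ, beamVec_ray, Pi.single_apply]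

theorem beamVec_succ (hA : Irred A) {m : ℤ} {U : Set (Shift A)} (hU : IsBeamAt m U) :
    beamVec U (m + 1) = beamVec U m ᵥ* A := by
  ext J
  have := congr_fun (beamVecQ_succ hA hU) J
  simp only [beamVecQ, Matrix.vecMul, dotProduct, Matrix.map_apply] at this
  simp only [Matrix.vecMul, dotProduct]
  exact_mod_cast this

theorem ray_shift (y : Shift A) (m : ℤ) : ray (shift A y) m = shift A '' ray y (m + 1) := by
  ext z
  constructor
  · intro hz
    refine ⟨(shift A).symm z, fun i hi => ?_, (shift A).apply_symm_apply z⟩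
    have := hz (i - 1) (by omega)
    change z (i - 1) = y (i - 1 + 1) at this
    rwa [sub_add_cancel] at this
  · rintro ⟨w, hw, rfl⟩ i hi
    exact hw (i + 1) (by omega)

theorem beamVec_shift (U : Set (Shift A)) (m : ℤ) :
    beamVec (shift A '' U) m = beamVec U (m + 1) := by
  ext J
  have : raysEndingAt (shift A '' U) m J =
      (fun R => shift A '' R) '' raysEndingAt U (m + 1) J := by
    ext R
    constructor
    · rintro ⟨_, ⟨⟨y, hy, rfl⟩, hJ⟩, rfl⟩
      exact ⟨_, ⟨y, ⟨hy, hJ⟩, rfl⟩, (ray_shift y m).symm⟩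
    · rintro ⟨_, ⟨y, ⟨hy, hJ⟩, rfl⟩, rfl⟩
      exact ⟨shift A y, ⟨⟨y, hy, rfl⟩, hJ⟩, ray_shift y m⟩
  rw [beamVec, this, ncard_image_of_injective _ (image_injective.2 (shift A).injective), beamVec]

/-! ### The transition matrix of an automorphism -/

/-- For an `m`-beam `U`, the `(m + l)`-rays in `φ(U)` are counted by the matrix `C`. -/
structure IsTransition (φ : Aut A) (l : ℕ) (C : Matrix (Fin k) (Fin k) ℕ) : Prop where
  isBeamAt : ∀ {m : ℤ} {U : Set (Shift A)}, IsBeamAt m U → IsBeamAt (m + l) (φ '' U)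
  beamVec_image : ∀ {m : ℤ} {U : Set (Shift A)}, IsBeamAt m U →
    beamVec (φ '' U) (m + l) = beamVec U m ᵥ* C

/-- At one fixed time the counts depend only on the terminal state, by `beamVec_image_ray`;
commutation with the shift carries this to all times. Disjointness of rays then extends it from rays
to beams. -/
theorem exists_isTransition (hA : Irred A) (φ : Aut A) :
    ∃ (l : ℕ) (C : Matrix (Fin k) (Fin k) ℕ), IsTransition φ l C := by
  obtain ⟨r, hr, hr'⟩ := φ.exists_range
  choose p hp using hA.exists_point 0
  -- The smallest delay allowed by the strict bound in `beamVec_image_ray`.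
  let l : ℕ := 3 * r + 1
  let C : Matrix (Fin k) (Fin k) ℕ := fun I J => beamVec (φ '' ray (p I) 0) l J
  have hstep : ∀ (x : Shift A) (m : ℤ), beamVec (φ '' ray (shift A x) m) (m + l) =
      beamVec (φ '' ray x (m + 1)) (m + 1 + l) := fun x m => by
    have : φ '' ray (shift A x) m = shift A '' (φ '' ray x (m + 1)) := by
      rw [ray_shift, image_image, image_image]
      exact image_congr fun y _ => φ.2 y
    rw [this, beamVec_shift]
    congr 1
    ring
  have hC : ∀ (m : ℤ) (x : Shift A), beamVec (φ '' ray x m) (m + l) = C (x m).tgt := by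
    intro m
    induction m using Int.induction_on with
    | zero =>
      intro x
      ext J
      rw [zero_add]
      exact beamVec_image_ray hr hr' (by omega) (hp _).symm J
    | succ m ih =>
      intro x
      rw [← hstep, ih]
      rfl
    | pred m ih =>
      intro x
      obtain ⟨y, rfl⟩ := (shift A).surjective x
      rw [hstep, show -(m : ℤ) - 1 + 1 = -m by ring, ih]
      change _ = C (y (-(m : ℤ) - 1 + 1)).tgt
      rw [sub_add_cancel]
  refine ⟨l, C, fun hU => hU.image hr hr' (by omega), fun {m U} hU => ?_⟩
  ext J
  rw [beamVec_image_eq_sum hU (hU.image hr hr' (by omega))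
    (fun y z h i hi => hr'.agree_symm h i (by omega)) C (fun x _ J => by rw [hC])]
  rfl

/-- The rays of `φ(R(x, 0))` at time `l + 1` are counted in two ways: the ray is refined by one step
before applying `φ`, or its image is refined afterwards. -/
theorem IsTransition.commute {φ : Aut A} {l : ℕ} {C : Matrix (Fin k) (Fin k) ℕ}
    (h : IsTransition φ l C) (hA : Irred A) : C * A = A * C := by
  ext I J
  obtain ⟨x, rfl⟩ := hA.exists_point 0 I
  have hx := isBeamAt_ray x 0
  have h1 := h.beamVec_image (hx.mono (show (0 : ℤ) ≤ 0 + 1 by omega))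
  rw [beamVec_succ hA hx, show (0 : ℤ) + 1 + l = 0 + l + 1 by ring,
    beamVec_succ hA (h.isBeamAt hx), h.beamVec_image hx, beamVec_ray,
    Matrix.vecMul_vecMul, Matrix.vecMul_vecMul, Matrix.single_one_vecMul,
    Matrix.single_one_vecMul] at h1
  exact congr_fun h1 J

/-! ### Homomorphisms on the dimension group -/

theorem dimGroup_hom_ext {G : Type*} [AddCommGroup G] {f g : DimGroup A →+ G}
    (h : ∀ U, f (beamClass U) = g (beamClass U)) : f = g :=
  QuotientAddGroup.addMonoidHom_ext _ (FreeAbelianGroup.lift_ext _ _ fun U => h U)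

/-- Two `m`-rays are equal or disjoint, so a ray that meets an `m`-beam is already contained in it.
Adding the rays one by one thus needs only disjoint unions, the case in which classes are additive.
-/
theorem IsBeamAt.induction {m : ℤ} {p : Set (Shift A) → Prop} (h0 : p ∅)
    (h1 : ∀ U x, IsBeamAt m U → Disjoint U (ray x m) → p U → p (U ∪ ray x m))
    {U : Set (Shift A)} (hU : IsBeamAt m U) : p U := by
  obtain ⟨s, hs, rfl⟩ := hU
  induction s, hs using Set.Finite.induction_on with
  | empty => simpa using h0
  | @insert x s _ hs ih =>
    rw [biUnion_insert, union_comm]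
    have hb : IsBeamAt m (⋃ x ∈ s, ray x m) := ⟨s, hs, rfl⟩
    by_cases hx : Disjoint (⋃ x ∈ s, ray x m) (ray x m)
    · exact h1 _ x hb hx ih
    · obtain ⟨y, hy, hyx⟩ := Set.not_disjoint_iff.1 hx
      rw [union_eq_self_of_subset_right]
      · exact ih
      · rw [← ray_eq_of_mem hyx]
        exact (isBeamAt_iff.1 hb).1 y hy

theorem isBeamAt_empty (m : ℤ) : IsBeamAt m (∅ : Set (Shift A)) := ⟨∅, finite_empty, by simp⟩

/-- The empty beam. -/
def emptyBeam : Beam A := ⟨∅, 0, isBeamAt_empty 0⟩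

theorem beamClass_empty : beamClass (emptyBeam : Beam A) = 0 := by
  have := beamClass_union (U := emptyBeam (A := A)) (V := emptyBeam) (W := emptyBeam)
    (disjoint_bot_left) (union_empty _).symm
  simpa using this

/-- The classes of rays generate the dimension group. -/
theorem dimGroup_hom_ext_ray {G : Type*} [AddCommGroup G] {f g : DimGroup A →+ G}
    (h : ∀ x n, f (beamClass (rayBeam x n)) = g (beamClass (rayBeam x n))) : f = g := by
  refine dimGroup_hom_ext fun U => ?_
  obtain ⟨U, m, hU⟩ := U
  -- The class depends on a proof of `IsBeam U`; quantifying over it leaves a predicate of the set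
  -- alone, to which the induction applies.
  have : ∀ hU' : IsBeam U, f (beamClass ⟨U, hU'⟩) = g (beamClass ⟨U, hU'⟩) := by
    refine IsBeamAt.induction (p := fun U => ∀ hU' : IsBeam U,
      f (beamClass ⟨U, hU'⟩) = g (beamClass ⟨U, hU'⟩)) ?_ ?_ hU
    · intro hU'
      rw [show (⟨∅, hU'⟩ : Beam A) = emptyBeam from rfl, beamClass_empty, map_zero, map_zero]
    · intro U x hU hd ih hU'
      have hb : IsBeam U := ⟨m, hU⟩
      rw [beamClass_union (U := ⟨U, hb⟩) (V := rayBeam x m) (W := ⟨_, hU'⟩) hd rfl, map_add,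
        map_add, ih, h]
  exact this _

theorem Aut.dimMap_beamClass (φ : Aut A) (U : Beam A) :
    φ.dimMap (beamClass U) = beamClass (φ.mapBeam U) :=
  dimLift_beamClass _ _ _ U

/-- The inverse automorphism. -/
def Aut.inv (φ : Aut A) : Aut A :=
  ⟨φ.1.symm, fun x => by rw [Homeomorph.symm_apply_eq, φ.2, Homeomorph.apply_symm_apply]⟩

theorem Aut.inv_apply_self (φ : Aut A) (x : Shift A) : φ.inv (φ x) = x :=
  φ.1.symm_apply_apply x

theorem Aut.apply_inv_self (φ : Aut A) (x : Shift A) : φ (φ.inv x) = x :=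
  φ.1.apply_symm_apply x

theorem Aut.dimMap_inv_dimMap (φ : Aut A) (d : DimGroup A) : φ.inv.dimMap (φ.dimMap d) = d := by
  refine DFunLike.congr_fun (f := φ.inv.dimMap.comp φ.dimMap) (g := AddMonoidHom.id _)
    (dimGroup_hom_ext fun U => ?_) d
  simp only [AddMonoidHom.comp_apply, AddMonoidHom.id_apply, Aut.dimMap_beamClass]
  congr 1
  refine Subtype.ext ?_
  change φ.inv '' (φ '' U.1) = U.1
  rw [image_image]
  simp only [Aut.inv_apply_self, image_id']

/-! ### The dimension representation -/

/-- This moves transition matrices past negative powers of `δ_A`. Here `f` is a bare map, so it need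
not be invertible. -/
theorem zpow_apply_comm {R M : Type*} [Ring R] [AddCommGroup M] [Module R M] (e : M ≃ₗ[R] M)
    (f : M → M) (h : ∀ x, f (e x) = e (f x)) (z : ℤ) (x : M) : f ((e ^ z) x) = (e ^ z) (f x) := by
  have hpos : ∀ (n : ℕ) x, f ((e ^ n) x) = (e ^ n) (f x) := fun n => by
    induction n with
    | zero => intro x; simp
    | succ n ih =>
      intro x
      rw [pow_succ, LinearEquiv.mul_apply, LinearEquiv.mul_apply, ih, h]
  obtain ⟨n, rfl | rfl⟩ := z.eq_nat_or_neg
  · simpa using hpos n x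
  · have h1 : ∀ y, (e ^ (n : ℤ)) ((e ^ (-(n : ℤ))) y) = y := fun y => by
      rw [← LinearEquiv.mul_apply, ← zpow_add, add_neg_cancel, zpow_zero]
      rfl
    apply (e ^ (n : ℤ)).injective
    rw [h1, zpow_natCast, ← hpos, ← zpow_natCast, h1]

theorem delta_coe (x : matGroup A) :
    (delta A x : Fin k → ℚ) = (x : Fin k → ℚ) ᵥ* ratMat A := rfl

theorem delta_pow_coe (n : ℕ) (x : matGroup A) :
    ((delta A ^ n) x : Fin k → ℚ) = (x : Fin k → ℚ) ᵥ* ratMat A ^ n := by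
  induction n with
  | zero => simp
  | succ n ih =>
    rw [pow_succ', LinearEquiv.mul_apply, delta_coe, ih, Matrix.vecMul_vecMul, pow_succ]

theorem natCast_vecMul (w : Fin k → ℕ) (C : Matrix (Fin k) (Fin k) ℕ) :
    (fun i => (w i : ℚ)) ᵥ* ratMat C = fun i => ((w ᵥ* C) i : ℚ) := by
  ext i
  simp [Matrix.vecMul, dotProduct]

theorem intCast_vecMul (w : Fin k → ℤ) (C : Matrix (Fin k) (Fin k) ℕ) :
    (fun i => (w i : ℚ)) ᵥ* ratMat C =
      fun i => ((w ᵥ* C.map (Nat.cast : ℕ → ℤ)) i : ℚ) := by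
  ext i
  simp [Matrix.vecMul, dotProduct]

theorem natCast_mul_comm {R : Type*} [Semiring R] {C : Matrix (Fin k) (Fin k) ℕ}
    (h : C * A = A * C) : C.map (Nat.cast : ℕ → R) * A.map (Nat.cast : ℕ → R) =
      A.map (Nat.cast : ℕ → R) * C.map (Nat.cast : ℕ → R) := by
  have h1 := Matrix.map_mul (L := A) (M := C) (f := Nat.castRingHom R)
  have h2 := Matrix.map_mul (L := C) (M := A) (f := Nat.castRingHom R)
  rw [h, h1] at h2
  exact h2.symm

theorem ratMat_mul_comm {C : Matrix (Fin k) (Fin k) ℕ} (h : C * A = A * C) :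
    Commute (ratMat C) (ratMat A) :=
  natCast_mul_comm h

/-- Right multiplication on `𝒢_A` by a matrix that commutes with `A`. -/
def commMul (C : Matrix (Fin k) (Fin k) ℕ) (h : C * A = A * C) : matGroup A →+ matGroup A where
  toFun x := ⟨(x : Fin k → ℚ) ᵥ* ratMat C, by
    obtain ⟨⟨y, hy⟩, -⟩ := x.2
    refine ⟨y ᵥ* ratMat C, ?_⟩
    rw [← hy]
    simp only [Matrix.vecMulLinear_apply, Matrix.vecMul_vecMul]
    rw [((ratMat_mul_comm h).pow_right k).eq], by
    obtain ⟨-, n, w, hw⟩ := x.2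
    refine ⟨n, w ᵥ* C.map (Nat.cast : ℕ → ℤ), ?_⟩
    rw [← intCast_vecMul, ← hw, Matrix.vecMul_vecMul, Matrix.vecMul_vecMul,
      ((ratMat_mul_comm h).pow_right n).eq]⟩
  map_zero' := Subtype.ext (by simp)
  map_add' x y := Subtype.ext (by simp [Matrix.add_vecMul])

theorem commMul_delta {C : Matrix (Fin k) (Fin k) ℕ} (h : C * A = A * C) (x : matGroup A) :
    commMul C h (delta A x) = delta A (commMul C h x) := by
  refine Subtype.ext ?_
  change ((x : Fin k → ℚ) ᵥ* ratMat A) ᵥ* ratMat C = ((x : Fin k → ℚ) ᵥ* ratMat C) ᵥ* ratMat A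
  rw [Matrix.vecMul_vecMul, Matrix.vecMul_vecMul, (ratMat_mul_comm h).eq]

theorem commMul_mem_matPos {C : Matrix (Fin k) (Fin k) ℕ} (h : C * A = A * C) {x : matGroup A}
    (hx : x ∈ matPos A) : commMul C h x ∈ matPos A := by
  obtain ⟨n, w, hw⟩ := hx
  refine ⟨n, w ᵥ* C, ?_⟩
  change ((x : Fin k → ℚ) ᵥ* ratMat C) ᵥ* ratMat A ^ n = _
  rw [← natCast_vecMul, ← hw, Matrix.vecMul_vecMul, Matrix.vecMul_vecMul,
    ((ratMat_mul_comm h).pow_right n).eq]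

theorem delta_mem_matPos {x : matGroup A} : delta A x ∈ matPos A ↔ x ∈ matPos A := by
  constructor
  · rintro ⟨n, w, hw⟩
    exact ⟨n + 1, w, by rw [pow_succ', ← Matrix.vecMul_vecMul]; exact hw⟩
  · exact commMul_mem_matPos (C := A) rfl

theorem delta_zpow_mem_matPos (z : ℤ) {x : matGroup A} :
    (delta A ^ z) x ∈ matPos A ↔ x ∈ matPos A := by
  induction z using Int.induction_on with
  | zero => simp
  | succ n ih =>
    rw [← ih, add_comm, zpow_add, zpow_one, LinearEquiv.mul_apply, delta_mem_matPos]
  | pred n ih =>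
    rw [← ih, ← delta_mem_matPos, ← LinearEquiv.mul_apply, ← zpow_one_add]
    ring_nf

/-- The classes of beams span `𝒢_A`. -/
theorem theta_surjective (hA : Irred A) : Function.Surjective (theta hA) := by
  intro g
  obtain ⟨-, n, w, hw⟩ := g.2
  choose x hx using hA.exists_point n
  refine ⟨∑ J, w J • beamClass (rayBeam (x J) n), ?_⟩
  -- With `g A^n = w` integral, `g A^{k+n} = w A^k`, and `w` is an integer combination of the unit
  -- vectors `v_{R,n}` of `n`-rays ending at each state.
  have key : (delta A ^ ((k : ℤ) + n)) g = ∑ J, w J • beamElt (ray (x J) n) n := by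
    refine Subtype.ext ?_
    rw [add_comm, ← Nat.cast_add, zpow_natCast, delta_pow_coe, pow_add, ← Matrix.vecMul_vecMul, hw,
      AddSubgroup.val_finsetSum]
    ext i
    rw [Finset.sum_apply]
    change ∑ J, (w J : ℚ) * (ratMat A ^ k) J i = _
    refine Finset.sum_congr rfl fun J _ => ?_
    change _ = (w J • (beamVecQ (ray (x J) n) n ᵥ* ratMat A ^ k)) i
    rw [beamVecQ_ray, hx, Matrix.single_one_vecMul]
    simp [Matrix.row]
  rw [map_sum]
  simp only [map_zsmul, theta_beamClass hA (rayBeam _ n) (isBeamAt_ray _ n)]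
  simp only [← map_zsmul, ← map_sum]
  change (delta A ^ (-(k : ℤ) - n)) (∑ J, w J • beamElt (ray (x J) n) n) = g
  rw [← key, ← LinearEquiv.mul_apply, ← zpow_add, show -(k : ℤ) - n + (k + n) = 0 by ring,
    zpow_zero]
  rfl

/-- The endomorphism `x ↦ δ_A^{-l}(x C)` of `𝒢_A`. -/
noncomputable def dimEnd (l : ℕ) (C : Matrix (Fin k) (Fin k) ℕ) (h : C * A = A * C) : matGroup A →+ matGroup A :=
  (delta A ^ (-(l : ℤ))).toLinearMap.toAddMonoidHom.comp (commMul C h)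

theorem dimEnd_apply (l : ℕ) {C : Matrix (Fin k) (Fin k) ℕ} (h : C * A = A * C) (x : matGroup A) :
    dimEnd l C h x = (delta A ^ (-(l : ℤ))) (commMul C h x) := rfl

theorem dimEnd_delta (l : ℕ) {C : Matrix (Fin k) (Fin k) ℕ} (h : C * A = A * C) (x : matGroup A) :
    dimEnd l C h (delta A x) = delta A (dimEnd l C h x) := by
  rw [dimEnd_apply, commMul_delta, dimEnd_apply,
    zpow_apply_comm (delta A) (fun x => delta A x) (fun _ => rfl)]

theorem dimEnd_mem_matPos (l : ℕ) {C : Matrix (Fin k) (Fin k) ℕ} (h : C * A = A * C)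
    {x : matGroup A} (hx : x ∈ matPos A) : dimEnd l C h x ∈ matPos A :=
  (delta_zpow_mem_matPos _).2 (commMul_mem_matPos h hx)

/-- On an `m`-beam, `φ` multiplies the counting vector by `C` but moves the counting time to `m +
l`; the factor `δ_A^{-l}` accounts for the delay. -/
theorem IsTransition.dimEnd_theta {φ : Aut A} {l : ℕ} {C : Matrix (Fin k) (Fin k) ℕ}
    (h : IsTransition φ l C) (hA : Irred A) (d : DimGroup A) :
    dimEnd l C (h.commute hA) (theta hA d) = theta hA (φ.dimMap d) := by
  refine DFunLike.congr_fun (f := (dimEnd l C (h.commute hA)).comp (theta hA))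
    (g := (theta hA).comp φ.dimMap) (dimGroup_hom_ext fun U => ?_) d
  obtain ⟨m, hm⟩ := U.2
  rw [AddMonoidHom.comp_apply, AddMonoidHom.comp_apply, Aut.dimMap_beamClass,
    theta_beamClass hA U hm, theta_beamClass hA (φ.mapBeam U) (h.isBeamAt hm), dimEnd_apply,
    zpow_apply_comm (delta A) (commMul C (h.commute hA)) (commMul_delta _),
    ← LinearEquiv.mul_apply, ← zpow_add]
  have he : commMul C (h.commute hA) (beamElt U.1 m) = beamElt (φ.mapBeam U).1 (m + l) := by
    refine Subtype.ext ?_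
    change (beamVecQ U.1 m ᵥ* ratMat A ^ k) ᵥ* ratMat C =
      beamVecQ (φ '' U.1) (m + l) ᵥ* ratMat A ^ k
    have : beamVecQ (φ '' U.1) (m + l) = beamVecQ U.1 m ᵥ* ratMat C := by
      ext J
      rw [beamVecQ, h.beamVec_image hm]
      exact (congr_fun (natCast_vecMul _ C) J).symm
    rw [this, Matrix.vecMul_vecMul, Matrix.vecMul_vecMul,
      ((ratMat_mul_comm (h.commute hA)).pow_right k).eq]
  rw [he]
  congr 2
  ring

/-- Surjectivity of `θ` transfers the identity from `D_A`, where it says that `φ⁻¹` undoes `φ`. No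
identity between `C` and `C'` has to be found. -/
theorem IsTransition.dimEnd_inv {φ : Aut A} {l l' : ℕ} {C C' : Matrix (Fin k) (Fin k) ℕ}
    (h : IsTransition φ l C) (h' : IsTransition φ.inv l' C') (hA : Irred A) (x : matGroup A) :
    dimEnd l' C' (h'.commute hA) (dimEnd l C (h.commute hA) x) = x := by
  obtain ⟨d, rfl⟩ := theta_surjective hA x
  rw [h.dimEnd_theta, h'.dimEnd_theta, Aut.dimMap_inv_dimMap]

/-- The automorphism `S_φ` exists, and it is given by a transition matrix. -/
theorem IsTransition.exists_isDimRep {φ : Aut A} {l : ℕ} {C : Matrix (Fin k) (Fin k) ℕ}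
    (h : IsTransition φ l C) (hA : Irred A) :
    ∃ S : MatAut A, IsDimRep hA φ S ∧ ∀ x, S x = dimEnd l C (h.commute hA) x := by
  obtain ⟨l', C', h'⟩ := exists_isTransition hA φ.inv
  let e : matGroup A ≃+ matGroup A :=
    { dimEnd l C (h.commute hA) with
      invFun := dimEnd l' C' (h'.commute hA)
      left_inv := h.dimEnd_inv h' hA
      -- The inverse of `φ.inv` is `φ` by definition, so `h` serves as its transition matrix.
      right_inv := h'.dimEnd_inv (φ := φ.inv) h hA }
  refine ⟨e.toIntLinearEquiv, ⟨h.dimEnd_theta hA, fun g => ⟨fun hg => ?_, ?_⟩, dimEnd_delta l _⟩,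
    fun _ => rfl⟩
  · rw [← h.dimEnd_inv h' hA g]
    exact dimEnd_mem_matPos _ _ hg
  · exact dimEnd_mem_matPos _ _

theorem IsDimRep.unique {hA : Irred A} {φ : Aut A} {S T : MatAut A} (hS : IsDimRep hA φ S)
    (hT : IsDimRep hA φ T) : S = T := by
  refine LinearEquiv.ext fun g => ?_
  obtain ⟨d, rfl⟩ := theta_surjective hA g
  rw [hS.comm, hT.comm]

end SFT

namespace SFT

variable {k : ℕ} {A : Matrix (Fin k) (Fin k) ℕ}

/-! ### States -/

/-- `v` is a positive right eigenvector of `A` for `λ_A`. -/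
def IsPerronVec (A : Matrix (Fin k) (Fin k) ℕ) (v : Fin k → ℝ) : Prop :=
  (∀ i, 0 < v i) ∧ A.map (Nat.cast : ℕ → ℝ) *ᵥ v = perron A • v

/-- The pairing of `𝒢_A` with a column vector. -/
noncomputable def pairing (A : Matrix (Fin k) (Fin k) ℕ) (v : Fin k → ℝ) : matGroup A →+ ℝ where
  toFun x := ∑ i, (((x : Fin k → ℚ) i : ℚ) : ℝ) * v i
  map_zero' := by simp
  map_add' x y := by simp [add_mul, Finset.sum_add_distrib]

theorem pairing_apply (v : Fin k → ℝ) (x : matGroup A) :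
    pairing A v x = ∑ i, (((x : Fin k → ℚ) i : ℚ) : ℝ) * v i := rfl

theorem pairing_smul (t : ℝ) (v : Fin k → ℝ) (x : matGroup A) :
    pairing A (t • v) x = t * pairing A v x := by
  rw [pairing_apply, pairing_apply, Finset.mul_sum]
  exact Finset.sum_congr rfl fun i _ => by simp; ring

theorem sum_ratMat_vecMul (C : Matrix (Fin k) (Fin k) ℕ) (v : Fin k → ℝ) (x : Fin k → ℚ) :
    ∑ i, (((x ᵥ* ratMat C) i : ℚ) : ℝ) * v i =
      ∑ i, (x i : ℝ) * (C.map (Nat.cast : ℕ → ℝ) *ᵥ v) i := by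
  simp only [Matrix.vecMul, Matrix.mulVec, dotProduct, Matrix.map_apply, Rat.cast_sum,
    Rat.cast_mul, Rat.cast_natCast, Finset.sum_mul, Finset.mul_sum]
  rw [Finset.sum_comm]
  simp only [mul_assoc]

theorem pairing_commMul {C : Matrix (Fin k) (Fin k) ℕ} (h : C * A = A * C) (v : Fin k → ℝ)
    (x : matGroup A) :
    pairing A v (commMul C h x) = pairing A (C.map (Nat.cast : ℕ → ℝ) *ᵥ v) x :=
  sum_ratMat_vecMul C v x

theorem IsPerronVec.pairing_delta {v : Fin k → ℝ} (hv : IsPerronVec A v) (x : matGroup A) :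
    pairing A v (delta A x) = perron A * pairing A v x := by
  rw [← pairing_smul, ← hv.2]
  exact pairing_commMul (C := A) rfl v x

theorem IsPerronVec.pairing_delta_zpow [Nonempty (Fin k)] (hA : Irred A) {v : Fin k → ℝ}
    (hv : IsPerronVec A v) (z : ℤ) (x : matGroup A) :
    pairing A v ((delta A ^ z) x) = perron A ^ z * pairing A v x := by
  have h0 := hA.perron_pos.ne'
  induction z using Int.induction_on with
  | zero => simp
  | succ n ih =>
    rw [add_comm, zpow_add, zpow_one, LinearEquiv.mul_apply, hv.pairing_delta, ih,
      zpow_one_add₀ h0, mul_assoc]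
  | pred n ih =>
    refine mul_left_cancel₀ h0 ?_
    rw [← hv.pairing_delta, ← LinearEquiv.mul_apply, ← zpow_one_add, ← mul_assoc,
      ← zpow_one_add₀ h0, show 1 + (-(n : ℤ) - 1) = -n by ring, ih]

/-- The homomorphism on `D_A` given by a right eigenvector of `A`. -/
noncomputable def perronState (hA : Irred A) (v : Fin k → ℝ) : DimGroup A →+ ℝ :=
  (pairing A v).comp (theta hA)

theorem perronState_apply (hA : Irred A) (v : Fin k → ℝ) (d : DimGroup A) :
    perronState hA v d = pairing A v (theta hA d) := rfl

theorem IsState.unique {μ : ∀ x : Shift A, Measure (Unstable x)} {τ τ' : DimGroup A →+ ℝ}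
    (h : IsState μ τ) (h' : IsState μ τ') : τ = τ' :=
  dimGroup_hom_ext_ray fun x n => by rw [h.ray, h'.ray]

variable [Nonempty (Fin k)]

/-- The power `A^k` in `beamElt` contributes `λ_A^k`, which cancels against the `-k` in the exponent
of `δ_A`; what remains is the canonical measure of an `n`-beam. -/
theorem IsPerronVec.perronState_beamClass (hA : Irred A) {v : Fin k → ℝ} (hv : IsPerronVec A v)
    (U : Beam A) {n : ℤ} (hn : IsBeamAt n U.1) :
    perronState hA v (beamClass U) = perron A ^ (-n) * ∑ J, (beamVec U.1 n J : ℝ) * v J := by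
  rw [perronState_apply, theta_beamClass hA U hn, hv.pairing_delta_zpow hA]
  have h1 : pairing A v (beamElt U.1 n) = perron A ^ k * ∑ J, (beamVec U.1 n J : ℝ) * v J := by
    have hp : ratMat A ^ k = ratMat (A ^ k) :=
      (Matrix.map_pow A (Nat.castRingHom ℚ) k).symm
    have hp' : (A ^ k).map (Nat.cast : ℕ → ℝ) = A.map (Nat.cast : ℕ → ℝ) ^ k :=
      Matrix.map_pow A (Nat.castRingHom ℝ) k
    rw [pairing_apply]
    change ∑ i, (((beamVecQ U.1 n ᵥ* ratMat A ^ k) i : ℚ) : ℝ) * v i = _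
    rw [hp, sum_ratMat_vecMul, hp', Matrix.pow_mulVec_eq_smul hv.2, Finset.mul_sum]
    refine Finset.sum_congr rfl fun J _ => ?_
    simp only [beamVecQ, Rat.cast_natCast, Pi.smul_apply, smul_eq_mul]
    ring
  rw [h1, ← mul_assoc, ← zpow_natCast, ← zpow_add₀ hA.perron_pos.ne']
  congr 2
  ring

theorem IsPerronVec.perronState_ray (hA : Irred A) {v : Fin k → ℝ} (hv : IsPerronVec A v)
    (x : Shift A) (n : ℤ) :
    perronState hA v (beamClass (rayBeam x n)) = perron A ^ (-n) * v (x n).tgt := by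
  rw [hv.perronState_beamClass hA (rayBeam x n) (isBeamAt_ray x n)]
  congr 1
  change ∑ J, (beamVec (ray x n) n J : ℝ) * v J = _
  simp [beamVec_ray, Pi.single_apply]

theorem IsPerronVec.perronState_nonneg (hA : Irred A) {v : Fin k → ℝ} (hv : IsPerronVec A v)
    (U : Beam A) : 0 ≤ perronState hA v (beamClass U) := by
  obtain ⟨n, hn⟩ := U.2
  rw [hv.perronState_beamClass hA U hn]
  exact mul_nonneg (zpow_nonneg hA.perron_pos.le _)
    (Finset.sum_nonneg fun J _ => mul_nonneg (Nat.cast_nonneg _) (hv.1 J).le)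

theorem IsPerronVec.ray_pos (hA : Irred A) {v : Fin k → ℝ} (hv : IsPerronVec A v) (n : ℤ)
    (J : Fin k) : 0 < perron A ^ (-n) * v J :=
  mul_pos (zpow_pos hA.perron_pos _) (hv.1 J)

/-! ### The scaling factor of an automorphism -/

theorem IsPerronVec.eq_smul (hA : Irred A) {v w : Fin k → ℝ} (hv : IsPerronVec A v)
    (hw : A.map (Nat.cast : ℕ → ℝ) *ᵥ w = perron A • w) : ∃ t : ℝ, w = t • v :=
  Matrix.IsIrreducible.eigenvector_unique hA hv.1 hv.2 hw

/-- A transition matrix acts on Perron vectors as a nonnegative scalar, a multiple of the factor by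
which the automorphism scales states. -/
theorem IsTransition.exists_scale (hA : Irred A) {φ : Aut A} {l : ℕ}
    {C : Matrix (Fin k) (Fin k) ℕ} (h : IsTransition φ l C) :
    ∃ c : ℝ, 0 ≤ c ∧ ∀ v, IsPerronVec A v →
      C.map (Nat.cast : ℕ → ℝ) *ᵥ v = (c * perron A ^ l) • v ∧
      ∀ d, perronState hA v (φ.dimMap d) = c * perronState hA v d := by
  obtain ⟨v₀, hv₀⟩ : ∃ v, IsPerronVec A v := hA.exists_right_eigenvector
  have hl := pow_pos hA.perron_pos l
  -- As `C` commutes with `A`, it preserves the one-dimensional Perron eigenspace.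
  obtain ⟨t, ht⟩ := hv₀.eq_smul hA (w := C.map (Nat.cast : ℕ → ℝ) *ᵥ v₀) (by
    rw [Matrix.mulVec_mulVec, ← natCast_mul_comm (h.commute hA), ← Matrix.mulVec_mulVec, hv₀.2, Matrix.mulVec_smul])
  have ht0 : 0 ≤ t := by
    obtain ⟨i⟩ := ‹Nonempty (Fin k)›
    have h1 : 0 ≤ (C.map (Nat.cast : ℕ → ℝ) *ᵥ v₀) i := by
      rw [Matrix.mulVec, dotProduct]
      exact Finset.sum_nonneg fun j _ => mul_nonneg (Nat.cast_nonneg (C i j)) (hv₀.1 j).le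
    rw [ht] at h1
    exact nonneg_of_mul_nonneg_left h1 (hv₀.1 i)
  -- The delay `l` of the transition matrix inflates its eigenvalue by `λ_A^l`.
  refine ⟨t / perron A ^ l, div_nonneg ht0 hl.le, fun v hv => ?_⟩
  have hCv : C.map (Nat.cast : ℕ → ℝ) *ᵥ v = t • v := by
    obtain ⟨s, rfl⟩ := hv₀.eq_smul hA hv.2
    rw [Matrix.mulVec_smul, ht, smul_comm]
  refine ⟨by rw [hCv, div_mul_cancel₀ _ hl.ne'], fun d => ?_⟩
  rw [perronState_apply, ← h.dimEnd_theta hA, dimEnd_apply, hv.pairing_delta_zpow hA,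
    pairing_commMul, hCv, pairing_smul, ← perronState_apply, zpow_neg, zpow_natCast]
  ring

theorem IsPerronVec.scale_unique (hA : Irred A) {v : Fin k → ℝ} (hv : IsPerronVec A v)
    {φ : Aut A} {c c' : ℝ} (h : ∀ d, perronState hA v (φ.dimMap d) = c * perronState hA v d)
    (h' : ∀ d, perronState hA v (φ.dimMap d) = c' * perronState hA v d) : c = c' := by
  obtain ⟨i⟩ := ‹Nonempty (Fin k)›
  obtain ⟨x, -⟩ := hA.exists_point 0 i
  have h1 := (h (beamClass (rayBeam x 0))).symm.trans (h' _)
  rw [hv.perronState_ray hA] at h1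
  exact mul_right_cancel₀ (hv.ray_pos hA 0 _).ne' h1

/-- The scaling factors of `φ` and `φ⁻¹` are inverse to each other. -/
theorem IsPerronVec.scale_mul_scale_inv (hA : Irred A) {v : Fin k → ℝ} (hv : IsPerronVec A v)
    {φ : Aut A} {c c' : ℝ} (h : ∀ d, perronState hA v (φ.dimMap d) = c * perronState hA v d)
    (h' : ∀ d, perronState hA v (φ.inv.dimMap d) = c' * perronState hA v d) : c' * c = 1 := by
  obtain ⟨i⟩ := ‹Nonempty (Fin k)›
  obtain ⟨x, -⟩ := hA.exists_point 0 i
  have h1 := h' (φ.dimMap (beamClass (rayBeam x 0)))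
  rw [Aut.dimMap_inv_dimMap, h, ← mul_assoc, hv.perronState_ray hA] at h1
  exact mul_right_cancel₀ (hv.ray_pos hA 0 _).ne' (h1.symm.trans (one_mul _).symm)

/-- The state of a canonical family of measures. -/
theorem IsUnstableMeasureFamily.isState (hA : Irred A) {μ : ∀ x : Shift A, Measure (Unstable x)}
    {v : Fin k → ℝ} (hv : IsPerronVec A v)
    (h : ∀ (x : Shift A) (y : Unstable x) (m : ℤ),
      μ x (unstableRay x y.pt m) = ENNReal.ofReal (perron A ^ (-m) * v (y.pt m).tgt)) :
    IsState μ (perronState hA v) where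
  nonneg := hv.perronState_nonneg hA
  ray x n := by
    rw [hv.perronState_ray hA, h x ⟨x, mem_iUnion.2 ⟨0, self_mem_ray x 0⟩⟩ n,
      ENNReal.toReal_ofReal (hv.ray_pos hA n _).le]

end SFT

namespace SFT

variable {k : ℕ} {A : Matrix (Fin k) (Fin k) ℕ}

/-! ### The topology of unstable sets -/

theorem Unstable.pt_injective {x : Shift A} : Function.Injective (Unstable.pt (x := x)) := by
  rintro ⟨y, hy⟩ ⟨z, hz⟩ rfl
  rfl

/-- The base point of an unstable set. -/
def Unstable.base (x : Shift A) : Unstable x := ⟨x, mem_iUnion.2 ⟨0, self_mem_ray x 0⟩⟩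

theorem ray_subset_unstable {x : Shift A} (y : Unstable x) (m : ℤ) :
    ray y.pt m ⊆ range (Unstable.pt (x := x)) := by
  intro z hz
  obtain ⟨n, hn⟩ := mem_iUnion.1 y.mem
  refine ⟨⟨z, mem_iUnion.2 ⟨min m n, fun i hi => ?_⟩⟩, rfl⟩
  rw [hz i (hi.trans (min_le_left _ _)), hn i (hi.trans (min_le_right _ _))]

theorem image_unstableRay {x : Shift A} (y : Unstable x) (m : ℤ) :
    Unstable.pt '' unstableRay x y.pt m = ray y.pt m :=
  image_preimage_eq_of_subset (ray_subset_unstable y m)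

/-- The point `y` need not lie in `W^u(x)`: the trace of its ray is empty, or else is a basic open
set around any of its points. -/
theorem isOpen_unstableRay (x y : Shift A) (m : ℤ) : IsOpen (unstableRay x y m) := by
  rcases eq_empty_or_nonempty (unstableRay x y m) with h | ⟨z, hz⟩
  · rw [h]
    exact isOpen_empty
  · refine TopologicalSpace.isOpen_generateFrom_of_mem ⟨z, m, ?_⟩
    ext w
    rw [unstableRay, ← ray_eq_of_mem hz]
    rfl

theorem preimage_biUnion_ray (x : Shift A) (s : Set (Shift A)) (m : ℤ) :
    Unstable.pt ⁻¹' (⋃ y ∈ s, ray y m) = ⋃ y ∈ s, unstableRay x y m := by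
  simp only [preimage_iUnion]
  rfl

theorem IsBeam.isOpen_preimage {U : Set (Shift A)} (hU : IsBeam U) (x : Shift A) :
    IsOpen (Unstable.pt (x := x) ⁻¹' U) := by
  obtain ⟨m, s, -, rfl⟩ := hU
  rw [preimage_biUnion_ray]
  exact isOpen_biUnion fun y _ => isOpen_unstableRay x y m

theorem isClosed_ray (y : Shift A) (m : ℤ) : IsClosed (ray y m) := by
  simp only [ray, ofPred_forall]
  exact isClosed_iInter fun i => isClosed_iInter fun _ =>
    isClosed_eq (Shift.continuous_apply i) continuous_const

/-- A ray is closed in the compact space `X_A`, and on it the topology of `W^u(x)` is no finer than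
that of `X_A`: inside an `m`-ray, an `n`-ray is cut out by the coordinates in `(m, n]`. -/
theorem isCompact_unstableRay {x : Shift A} (y : Unstable x) (m : ℤ) :
    IsCompact (unstableRay x y.pt m) := by
  have : CompactSpace (ray y.pt m) :=
    isCompact_iff_compactSpace.1 (isClosed_ray y.pt m).isCompact
  choose g hg using fun z : ray y.pt m => ray_subset_unstable y m z.2
  have hr : range g = unstableRay x y.pt m := by
    ext w
    constructor
    · rintro ⟨z, rfl⟩
      change (g z).pt ∈ ray y.pt m
      rw [hg]
      exact z.2
    · exact fun hw => ⟨⟨w.pt, hw⟩, Unstable.pt_injective (hg _)⟩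
  rw [← hr]
  refine isCompact_range (continuous_generateFrom_iff.2 ?_)
  rintro _ ⟨w, n, rfl⟩
  rcases eq_empty_or_nonempty (g ⁻¹' unstableRay x w.pt n) with h | ⟨z, hz⟩
  · rw [h]
    exact isOpen_empty
  · have hmem : ∀ a, a ∈ g ⁻¹' unstableRay x w.pt n ↔ a.1 ∈ ray w.pt n := fun a => by
      change (g a).pt ∈ ray w.pt n ↔ _
      rw [hg]
    have : g ⁻¹' unstableRay x w.pt n =
        ⋂ i ∈ Finset.Ioc m n, {a : ray y.pt m | a.1 i = z.1 i} := by
      ext a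
      rw [hmem]
      rw [hmem] at hz
      simp only [mem_iInter, Finset.mem_Ioc, mem_ofPred_eq]
      constructor
      · intro ha i hi
        rw [ha i hi.2, hz i hi.2]
      · intro ha i hi
        rw [← hz i hi]
        rcases le_or_gt i m with him | him
        · rw [a.2 i him, z.2 i him]
        · exact ha i ⟨him, hi⟩
    rw [this]
    refine isOpen_biInter_finset fun i _ => ?_
    exact (isOpen_discrete {z.1 i}).preimage
      ((Shift.continuous_apply i).comp continuous_subtype_val)

theorem isCompact_of_isBeam {x : Shift A} {T : Set (Unstable x)}
    (hT : IsBeam (Unstable.pt '' T)) : IsCompact T := by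
  obtain ⟨m, s, hs, hU⟩ := hT
  rw [← preimage_image_eq T Unstable.pt_injective, hU, preimage_biUnion_ray]
  refine hs.isCompact_biUnion fun y hy => ?_
  have : y ∈ Unstable.pt '' T := hU ▸ mem_biUnion hy (self_mem_ray y m)
  obtain ⟨z, -, rfl⟩ := this
  exact isCompact_unstableRay z m

theorem isOpen_of_isBeam {x : Shift A} {T : Set (Unstable x)}
    (hT : IsBeam (Unstable.pt '' T)) : IsOpen T := by
  rw [← preimage_image_eq T Unstable.pt_injective]
  exact hT.isOpen_preimage x

theorem countable_unstableRays (x : Shift A) :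
    {U | ∃ (y : Unstable x) (m : ℤ), U = unstableRay x y.pt m}.Countable := by
  have hfin : ∀ m n : ℤ, ((fun R : Set (Shift A) => Unstable.pt (x := x) ⁻¹' R) ''
      ((fun y => ray y (max m n)) '' ray x n)).Countable := fun m n =>
    ((isBeamAt_iff.1 ((isBeamAt_ray x n).mono (le_max_right m n))).2.image _).countable
  refine (countable_iUnion fun m => countable_iUnion fun n => hfin m n).mono ?_
  rintro _ ⟨y, m, rfl⟩
  obtain ⟨n, hn⟩ := mem_iUnion.1 y.mem
  -- Lowering `n` to `min m n` makes `max m (min m n) = m`, so `R(y, m)` itself is among the listed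
  -- rays.
  refine mem_iUnion.2 ⟨m, mem_iUnion.2 ⟨min m n, ray y.pt m, ⟨y.pt, ?_, ?_⟩, rfl⟩⟩
  · exact fun i hi => hn i (hi.trans (min_le_right _ _))
  · simp

instance (x : Shift A) : SecondCountableTopology (Unstable x) :=
  ⟨⟨_, countable_unstableRays x, rfl⟩⟩

/-! ### The ring of beams in an unstable set -/

theorem IsBeamAt.sdiff {m : ℤ} {U V : Set (Shift A)} (hU : IsBeamAt m U) (hV : IsBeamAt m V) :
    IsBeamAt m (U \ V) := by
  rw [isBeamAt_iff] at hU hV ⊢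
  refine ⟨fun y hy z hz => ⟨hU.1 y hy.1 hz, fun hzV => hy.2 ?_⟩,
    hU.2.subset (image_mono sdiff_subset)⟩
  refine hV.1 z hzV ?_
  rw [ray_eq_of_mem hz]
  exact self_mem_ray y m

theorem IsBeam.sdiff {U V : Set (Shift A)} (hU : IsBeam U) (hV : IsBeam V) : IsBeam (U \ V) := by
  obtain ⟨m, hm⟩ := hU
  obtain ⟨n, hn⟩ := hV
  exact ⟨max m n, (hm.mono (le_max_left _ _)).sdiff (hn.mono (le_max_right _ _))⟩

/-- The beams contained in `W^u(x)`. -/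
def unstableBeams (x : Shift A) : Set (Set (Unstable x)) := {T | IsBeam (Unstable.pt '' T)}

theorem isSetRing_unstableBeams (x : Shift A) : IsSetRing (unstableBeams x) where
  empty_mem := by
    change IsBeam _
    rw [image_empty]
    exact ⟨0, isBeamAt_empty 0⟩
  union_mem s t hs ht := by
    change IsBeam _
    rw [image_union]
    exact hs.union ht
  sdiff_mem s t hs ht := by
    change IsBeam _
    rw [image_sdiff Unstable.pt_injective]
    exact hs.sdiff ht

theorem unstableRay_mem_unstableBeams {x : Shift A} (y : Unstable x) (m : ℤ) :
    unstableRay x y.pt m ∈ unstableBeams x := by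
  change IsBeam _
  rw [image_unstableRay]
  exact isBeam_ray _ _

/-- By second countability the rays, which generate the topology, also generate the Borel sets;
conversely beams are open. -/
theorem borel_eq_generateFrom_unstableBeams (x : Shift A) :
    (inferInstance : MeasurableSpace (Unstable x)) =
      MeasurableSpace.generateFrom (unstableBeams x) := by
  refine le_antisymm ?_ (MeasurableSpace.generateFrom_le fun T hT =>
    (isOpen_of_isBeam hT).measurableSet)
  refine (borel_eq_generateFrom_of_subbasis (α := Unstable x) rfl).le.trans
    (MeasurableSpace.generateFrom_mono ?_)
  rintro _ ⟨y, m, rfl⟩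
  exact unstableRay_mem_unstableBeams y m

/-- The homeomorphism `W^u(x) → W^u(φ(x))` induced by an automorphism `φ`. -/
def Aut.unstableHomeo (φ : Aut A) (x : Shift A) : Unstable x ≃ₜ Unstable (φ x) where
  toFun := φ.unstableMap x
  invFun z := ⟨φ.inv z.pt, by
    have h : φ.inv z.pt ∈ ⋃ n : ℤ, ray (φ.inv (φ x)) n := (φ.inv.unstableMap (φ x) z).mem
    rwa [Aut.inv_apply_self] at h⟩
  left_inv y := Unstable.pt_injective (φ.inv_apply_self y.pt)
  right_inv z := Unstable.pt_injective (φ.apply_inv_self z.pt)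
  continuous_toFun := by
    refine continuous_generateFrom_iff.2 ?_
    rintro _ ⟨w, n, rfl⟩
    -- The preimage of a ray under `φ` is its image under `φ⁻¹`, which is a beam.
    convert ((isBeam_ray w.pt n).image φ.inv).isOpen_preimage x using 1
    ext y
    constructor
    · exact fun hy => ⟨φ y.pt, hy, φ.inv_apply_self _⟩
    · rintro ⟨a, ha, hay⟩
      change φ y.pt ∈ ray w.pt n
      rwa [← hay, Aut.apply_inv_self]
  continuous_invFun := by
    refine continuous_generateFrom_iff.2 ?_
    rintro _ ⟨w, n, rfl⟩
    convert ((isBeam_ray w.pt n).image φ).isOpen_preimage (φ x) using 1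
    ext y
    constructor
    · exact fun hy => ⟨φ.inv y.pt, hy, φ.apply_inv_self _⟩
    · rintro ⟨a, ha, hay⟩
      change φ.inv y.pt ∈ ray w.pt n
      rwa [← hay, Aut.inv_apply_self]

/-! ### Measures on unstable sets -/

variable [Nonempty (Fin k)]

open Classical in
/-- The content on the beams in `W^u(x)` given by a Perron vector. -/
noncomputable def unstableContent (hA : Irred A) {v : Fin k → ℝ} (hv : IsPerronVec A v)
    (x : Shift A) : AddContent ENNReal (unstableBeams x) :=
  (isSetRing_unstableBeams x).addContent_of_union
    (fun T => if h : IsBeam (Unstable.pt '' T) then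
      ENNReal.ofReal (perronState hA v (beamClass ⟨_, h⟩)) else 0)
    (by
      have he : IsBeam (Unstable.pt (x := x) '' ∅) := (isSetRing_unstableBeams x).empty_mem
      have : (⟨_, he⟩ : Beam A) = emptyBeam := Subtype.ext (image_empty _)
      rw [dif_pos he, this, beamClass_empty, map_zero, ENNReal.ofReal_zero])
    (fun {s t} hs ht hd => by
      have hst : IsBeam (Unstable.pt '' (s ∪ t)) :=
        (isSetRing_unstableBeams x).union_mem hs ht
      replace hs : IsBeam (Unstable.pt '' s) := hs
      replace ht : IsBeam (Unstable.pt '' t) := ht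
      rw [dif_pos hs, dif_pos ht, dif_pos hst,
        ← ENNReal.ofReal_add (hv.perronState_nonneg hA _) (hv.perronState_nonneg hA _), ← map_add,
        beamClass_union (U := ⟨_, hs⟩) (V := ⟨_, ht⟩) (W := ⟨_, hst⟩)
          ((disjoint_image_iff Unstable.pt_injective).2 hd) (image_union _ _ _)])

theorem unstableContent_apply (hA : Irred A) {v : Fin k → ℝ} (hv : IsPerronVec A v)
    (x : Shift A) {T : Set (Unstable x)} (hT : IsBeam (Unstable.pt '' T)) :
    unstableContent hA hv x T = ENNReal.ofReal (perronState hA v (beamClass ⟨_, hT⟩)) :=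
  dif_pos hT

/-- A beam is compact and its pieces are open, so a countable cover has a finite subcover and finite
subadditivity suffices. -/
theorem unstableContent_isSigmaSubadditive (hA : Irred A) {v : Fin k → ℝ}
    (hv : IsPerronVec A v) (x : Shift A) : (unstableContent hA hv x).IsSigmaSubadditive := by
  intro f hf hU
  obtain ⟨t, ht⟩ := (isCompact_of_isBeam hU).elim_finite_subcover f
    (fun i => isOpen_of_isBeam (hf i)) Subset.rfl
  have heq : ⋃ i, f i = ⋃ i ∈ t, f i := Subset.antisymm ht (iUnion₂_subset fun i _ =>
    subset_iUnion f i)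
  rw [heq]
  exact (addContent_biUnion_le (isSetRing_unstableBeams x) fun i _ => hf i).trans
    (ENNReal.sum_le_tsum t)

/-- The measure on `W^u(x)` given by a Perron vector. -/
noncomputable def unstableMeasure (hA : Irred A) {v : Fin k → ℝ} (hv : IsPerronVec A v)
    (x : Shift A) : Measure (Unstable x) :=
  (unstableContent hA hv x).measure (isSetRing_unstableBeams x).isSetSemiring
    (borel_eq_generateFrom_unstableBeams x).le (unstableContent_isSigmaSubadditive hA hv x)

theorem unstableMeasure_unstableRay (hA : Irred A) {v : Fin k → ℝ} (hv : IsPerronVec A v)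
    (x : Shift A) (y : Unstable x) (m : ℤ) :
    unstableMeasure hA hv x (unstableRay x y.pt m) =
      ENNReal.ofReal (perron A ^ (-m) * v (y.pt m).tgt) := by
  have hT := unstableRay_mem_unstableBeams y m
  rw [unstableMeasure, AddContent.measure_eq _ _ (borel_eq_generateFrom_unstableBeams x) _ hT,
    unstableContent_apply hA hv x hT, ← hv.perronState_ray hA]
  congr 3
  exact Subtype.ext (image_unstableRay y m)

theorem Irred.exists_isUnstableMeasureFamily (hA : Irred A) :
    ∃ μ : ∀ x : Shift A, Measure (Unstable x), IsUnstableMeasureFamily μ := by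
  obtain ⟨v, hv⟩ : ∃ v, IsPerronVec A v := hA.exists_right_eigenvector
  exact ⟨unstableMeasure hA hv, v, hv.1, hv.2, unstableMeasure_unstableRay hA hv⟩

/-- The canonical measures of beams are given by the state. -/
theorem IsPerronVec.measure_eq_perronState (hA : Irred A) {v : Fin k → ℝ} (hv : IsPerronVec A v)
    {x : Shift A} {μ : Measure (Unstable x)}
    (h : ∀ (y : Unstable x) (m : ℤ),
      μ (unstableRay x y.pt m) = ENNReal.ofReal (perron A ^ (-m) * v (y.pt m).tgt))
    {T : Set (Unstable x)} (hT : IsBeam (Unstable.pt '' T)) :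
    μ T = ENNReal.ofReal (perronState hA v (beamClass ⟨_, hT⟩)) := by
  obtain ⟨m, hm⟩ := id hT
  -- The claim is rephrased for subsets of `X_A`, where beam induction takes place; the inclusion in
  -- the range guarantees that each ray added starts from a point of `W^u(x)`.
  have key : ∀ hU : IsBeam (Unstable.pt '' T),
      Unstable.pt '' T ⊆ range (Unstable.pt (x := x)) → μ (Unstable.pt ⁻¹' (Unstable.pt '' T)) =
        ENNReal.ofReal (perronState hA v (beamClass ⟨_, hU⟩)) := by
    refine IsBeamAt.induction (p := fun U => ∀ hU : IsBeam U,
      U ⊆ range (Unstable.pt (x := x)) → μ (Unstable.pt ⁻¹' U) =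
        ENNReal.ofReal (perronState hA v (beamClass ⟨U, hU⟩))) ?_ ?_ hm
    · intro hU _
      rw [show (⟨∅, hU⟩ : Beam A) = emptyBeam from rfl, beamClass_empty]
      simp
    · intro U y hU hd ih hU' hsub
      have hb : IsBeam U := ⟨m, hU⟩
      obtain ⟨z, rfl⟩ := hsub (Or.inr (self_mem_ray y m))
      rw [preimage_union, measure_union (hd.preimage _)
        ((isBeam_ray z.pt m).isOpen_preimage x).measurableSet,
        ih hb (subset_union_left.trans hsub),
        beamClass_union (U := ⟨U, hb⟩) (V := rayBeam z.pt m) (W := ⟨_, hU'⟩) hd rfl, map_add,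
        ENNReal.ofReal_add (hv.perronState_nonneg hA _) (hv.perronState_nonneg hA _),
        hv.perronState_ray hA]
      congr 1
      exact h z m
  rw [← key hT (image_subset_range _ _), preimage_image_eq T Unstable.pt_injective]

/-! ### Scaling of measures and of states -/

theorem scalesMeasures_of_scale (hA : Irred A) {φ : Aut A} {c : ℝ} (hc : 0 ≤ c)
    (h : ∀ v, IsPerronVec A v → ∀ d, perronState hA v (φ.dimMap d) = c * perronState hA v d) :
    ScalesMeasures φ c := by
  rintro μ ⟨v, hv1, hv2, hμ⟩ x S hS
  have hv : IsPerronVec A v := ⟨hv1, hv2⟩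
  have hemb : MeasurableEmbedding (φ.unstableMap x) :=
    (φ.unstableHomeo x).isOpenEmbedding.measurableEmbedding
  have hfin : ∀ T ∈ unstableBeams x, μ x T ≠ ⊤ := fun T hT => by
    rw [hv.measure_eq_perronState hA (hμ x) hT]
    exact ENNReal.ofReal_ne_top
  -- Both measures are given by states on the beams, a π-system generating the Borel sets, and
  -- `W^u(x)` is exhausted by the rays `R(x, -i)` of finite measure.
  have heq : ENNReal.ofReal c • μ x = (μ (φ x)).comap (φ.unstableMap x) := by
    refine Measure.ext_of_generateFrom_of_iUnion (unstableBeams x)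
      (fun i : ℕ => unstableRay x (Unstable.base x).pt (-(i : ℤ)))
      (borel_eq_generateFrom_unstableBeams x) (isSetRing_unstableBeams x).isSetSemiring.isPiSystem
      ?_ (fun i => unstableRay_mem_unstableBeams _ _) (fun i => ?_) (fun T hT => ?_)
    · refine eq_univ_of_forall fun y => ?_
      obtain ⟨n, hn⟩ := mem_iUnion.1 y.mem
      exact mem_iUnion.2 ⟨n.natAbs, fun i hi => hn i (by omega)⟩
    · rw [Measure.smul_apply, smul_eq_mul]
      exact ENNReal.mul_ne_top ENNReal.ofReal_ne_top
        (hfin _ (unstableRay_mem_unstableBeams _ _))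
    · have himg : Unstable.pt '' (φ.unstableMap x '' T) = φ '' (Unstable.pt '' T) := by
        rw [image_image, image_image]
        rfl
      have hT' : IsBeam (Unstable.pt '' (φ.unstableMap x '' T)) := by
        rw [himg]
        exact IsBeam.image φ hT
      rw [hemb.comap_apply, hv.measure_eq_perronState hA (hμ (φ x)) hT', Measure.smul_apply,
        smul_eq_mul, hv.measure_eq_perronState hA (hμ x) hT, ← ENNReal.ofReal_mul hc, ← h v hv,
        Aut.dimMap_beamClass]
      congr 3
      exact Subtype.ext himg.symm
  rw [← hemb.comap_apply, ← heq, Measure.smul_apply, smul_eq_mul]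

theorem scalesMeasures_iff (hA : Irred A) {φ : Aut A} {lam : ℝ} (hlam : 0 < lam)
    (h : ∀ v, IsPerronVec A v → ∀ d, perronState hA v (φ.dimMap d) = lam * perronState hA v d)
    (c : ℝ) : ScalesMeasures φ c ↔ c = lam := by
  refine ⟨fun hc => ?_, fun hc => hc ▸ scalesMeasures_of_scale hA hlam.le h⟩
  obtain ⟨i⟩ := ‹Nonempty (Fin k)›
  obtain ⟨x, -⟩ := hA.exists_point 0 i
  obtain ⟨μ, hμ⟩ := Irred.exists_isUnstableMeasureFamily (A := A) (hA := hA)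
  have hS : MeasurableSet (unstableRay x (Unstable.base x).pt 0) :=
    (isOpen_unstableRay _ _ _).measurableSet
  have h1 := (hc μ hμ x _ hS).symm.trans (scalesMeasures_of_scale hA hlam.le h μ hμ x _ hS)
  obtain ⟨v, hv1, hv2, hv⟩ := hμ
  have hp := IsPerronVec.ray_pos hA ⟨hv1, hv2⟩ 0 ((Unstable.base x).pt 0).tgt
  rw [hv x, ENNReal.mul_left_inj (by simpa using hp) ENNReal.ofReal_ne_top] at h1
  -- `ENNReal.ofReal` sends every `c ≤ 0` to `0`, so a nonpositive factor must be excluded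
  -- separately.
  rcases le_or_gt c 0 with h0 | h0
  · rw [ENNReal.ofReal_of_nonpos h0, eq_comm, ENNReal.ofReal_eq_zero] at h1
    exact absurd h1 (not_le.2 hlam)
  · exact (ENNReal.ofReal_eq_ofReal_iff h0.le hlam.le).1 h1

theorem scalesState_iff (hA : Irred A) {φ : Aut A} {lam : ℝ}
    (h : ∀ v, IsPerronVec A v → ∀ d, perronState hA v (φ.dimMap d) = lam * perronState hA v d)
    (c : ℝ) : ScalesState φ c ↔ c = lam := by
  constructor
  · intro hc
    obtain ⟨μ, v, hv1, hv2, hv⟩ := hA.exists_isUnstableMeasureFamily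
    have hp : IsPerronVec A v := ⟨hv1, hv2⟩
    exact hp.scale_unique hA
      (hc μ _ ⟨v, hv1, hv2, hv⟩ (IsUnstableMeasureFamily.isState hA hp hv)) (h v hp)
  · rintro rfl μ τ ⟨v, hv1, hv2, hv⟩ hτ
    have hp : IsPerronVec A v := ⟨hv1, hv2⟩
    rw [hτ.unique (IsUnstableMeasureFamily.isState hA hp hv)]
    exact h v hp

end SFT

namespace SFT

variable {k : ℕ} {A : Matrix (Fin k) (Fin k) ℕ}

/-! ### The complexified dimension group -/

/-- Tensoring over `ℤ` lets only integers cross, but the denominator can be divided out on the `ℂ`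
side first. -/
theorem tmul_rat_smul {M : Type*} [AddCommGroup M] [Module ℚ M] (c : ℂ) (q : ℚ) (e : M) :
    (c * (q : ℂ)) ⊗ₜ[ℤ] e = c ⊗ₜ[ℤ] (q • e) := by
  have hd : (q.den : ℂ) ≠ 0 := by exact_mod_cast q.den_ne_zero
  have h1 : c * (q : ℂ) = q.num • (c / q.den) := by
    rw [zsmul_eq_mul]
    nth_rewrite 1 [Rat.cast_def]
    ring
  have h2 : c = (q.den : ℤ) • (c / q.den) := by
    rw [zsmul_eq_mul, Int.cast_natCast, mul_div_cancel₀ _ hd]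
  have h3 : (q.den : ℤ) • (q • e) = q.num • e := by
    rw [← Int.cast_smul_eq_zsmul ℚ, ← Int.cast_smul_eq_zsmul ℚ, smul_smul, Int.cast_natCast,
      Rat.den_mul_eq_num]
  rw [h1, TensorProduct.smul_tmul, ← h3, ← TensorProduct.smul_tmul, ← h2]

/-- The coordinatewise embedding `ℚ^k → ℂ^k`. -/
def ratCastVec (k : ℕ) : (Fin k → ℚ) →ₗ[ℤ] (Fin k → ℂ) :=
  AddMonoidHom.toIntLinearMap
    { toFun := fun x i => (x i : ℂ)
      map_zero' := by ext; simp
      map_add' := fun x y => by ext; simp }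

theorem ratCastVec_apply (x : Fin k → ℚ) (i : Fin k) : ratCastVec k x i = (x i : ℂ) := rfl

/-- A left inverse is `w ↦ ∑ w_i ⊗ e_i`; on pure tensors this works because rational scalars cross
the tensor sign. -/
theorem liftBaseChange_ratCastVec_injective (k : ℕ) :
    Function.Injective ((ratCastVec k).liftBaseChange ℂ) := by
  let g : (Fin k → ℂ) → ℂ ⊗[ℤ] (Fin k → ℚ) := fun w => ∑ i, w i ⊗ₜ Pi.single i 1
  have hadd : ∀ w w', g (w + w') = g w + g w' := fun w w' => by
    simp [g, TensorProduct.add_tmul, Finset.sum_add_distrib]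
  refine Function.LeftInverse.injective (g := g) fun t => ?_
  induction t with
  | zero => simp [g]
  | add a b ha hb => rw [map_add, hadd, ha, hb]
  | tmul c q =>
    rw [LinearMap.liftBaseChange_tmul]
    simp only [g, Pi.smul_apply, ratCastVec_apply, smul_eq_mul, tmul_rat_smul]
    rw [← TensorProduct.tmul_sum]
    congr 1
    ext i
    simp [Pi.single_apply]

/-- The map `𝒢_A ⊗ ℂ → ℂ^k`. -/
noncomputable def toComplexVec (A : Matrix (Fin k) (Fin k) ℕ) :
    (ℂ ⊗[ℤ] matGroup A) →ₗ[ℂ] (Fin k → ℂ) :=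
  ((ratCastVec k).comp (matGroup A).subtype.toIntLinearMap).liftBaseChange ℂ

theorem toComplexVec_tmul (c : ℂ) (x : matGroup A) :
    toComplexVec A (c ⊗ₜ x) = c • fun i => (((x : Fin k → ℚ) i : ℚ) : ℂ) :=
  LinearMap.liftBaseChange_tmul ..

/-- Flatness of `ℂ` over `ℤ` keeps the inclusion of `𝒢_A` in `ℚ^k` injective after tensoring.
Eigenvectors in `𝒢_A ⊗ ℂ` become ordinary row vectors. -/
theorem toComplexVec_injective (A : Matrix (Fin k) (Fin k) ℕ) :
    Function.Injective (toComplexVec A) := by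
  have h : ∀ t, toComplexVec A t = (ratCastVec k).liftBaseChange ℂ
      (LinearMap.lTensor ℂ (matGroup A).subtype.toIntLinearMap t) := fun t => by
    induction t with
    | zero => simp
    | add a b ha hb => simp only [map_add, ha, hb]
    | tmul c x =>
      rw [LinearMap.lTensor_tmul, LinearMap.liftBaseChange_tmul, toComplexVec_tmul]
      rfl
  intro s t hst
  rw [h, h] at hst
  exact Module.Flat.lTensor_preserves_injective_linearMap (M := ℂ)
    (matGroup A).subtype.toIntLinearMap Subtype.val_injective
    (liftBaseChange_ratCastVec_injective k hst)

theorem complexify_tmul (S : MatAut A) (c : ℂ) (x : matGroup A) :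
    complexify S (c ⊗ₜ x) = c ⊗ₜ S x := rfl

theorem ratCast_vecMul (C : Matrix (Fin k) (Fin k) ℕ) (x : Fin k → ℚ) :
    (fun i => (((x ᵥ* ratMat C) i : ℚ) : ℂ)) =
      (fun i => (x i : ℂ)) ᵥ* C.map (Nat.cast : ℕ → ℂ) := by
  ext i
  simp [Matrix.vecMul, dotProduct]

/-- If `S` is given by matrices, so is `S ⊗ 1`. -/
theorem toComplexVec_complexify {S : MatAut A} {B C : Matrix (Fin k) (Fin k) ℕ}
    (h : ∀ x : matGroup A, (S x : Fin k → ℚ) ᵥ* ratMat B = (x : Fin k → ℚ) ᵥ* ratMat C)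
    (t : ℂ ⊗[ℤ] matGroup A) :
    toComplexVec A (complexify S t) ᵥ* B.map (Nat.cast : ℕ → ℂ) =
      toComplexVec A t ᵥ* C.map (Nat.cast : ℕ → ℂ) := by
  induction t with
  | zero => simp
  | add a b ha hb => simp only [map_add, Matrix.add_vecMul, ha, hb]
  | tmul c x =>
    rw [complexify_tmul, toComplexVec_tmul, toComplexVec_tmul, Matrix.smul_vecMul,
      Matrix.smul_vecMul, ← ratCast_vecMul, ← ratCast_vecMul, h]

theorem toComplexVec_delta (t : ℂ ⊗[ℤ] matGroup A) :
    toComplexVec A (complexify (delta A) t) = toComplexVec A t ᵥ* A.map (Nat.cast : ℕ → ℂ) := by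
  rw [← toComplexVec_complexify (S := delta A) (B := 1) (C := A) (fun x => by
    rw [delta_coe, show ratMat (1 : Matrix (Fin k) (Fin k) ℕ) = 1 from
      Matrix.map_one _ Nat.cast_zero Nat.cast_one, Matrix.vecMul_one]),
    Matrix.map_one _ Nat.cast_zero Nat.cast_one, Matrix.vecMul_one]

variable [Nonempty (Fin k)]

/-- A positive left eigenvector of `A` gives an eigenvector of `δ_A ⊗ 1`. -/
theorem Irred.exists_complexify_delta_eq (hA : Irred A) {u : Fin k → ℝ} (hu0 : ∀ i, 0 < u i)
    (hu : u ᵥ* A.map (Nat.cast : ℕ → ℝ) = perron A • u) :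
    ∃ t : ℂ ⊗[ℤ] matGroup A, t ≠ 0 ∧
      complexify (delta A) t = (perron A : ℂ) • t := by
  have huC : (fun i => (u i : ℂ)) ᵥ* A.map (Nat.cast : ℕ → ℂ) =
      (perron A : ℂ) • fun i => (u i : ℂ) := by
    ext i
    have := congr_arg ((↑) : ℝ → ℂ) (congr_fun hu i)
    simpa [Matrix.vecMul, dotProduct] using this
  have hpow : (fun i => (u i : ℂ)) ᵥ* A.map (Nat.cast : ℕ → ℂ) ^ k =
      (perron A : ℂ) ^ k • fun i => (u i : ℂ) := by
    rw [← Matrix.mulVec_transpose] at huC ⊢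
    rw [Matrix.transpose_pow, Matrix.pow_mulVec_eq_smul huC]
  have hmem : ∀ j : Fin k, Pi.single j (1 : ℚ) ᵥ* ratMat A ^ k ∈ matGroup A := fun j =>
    ⟨⟨Pi.single j 1, rfl⟩, 0, Pi.single j 1 ᵥ* (A.map (Nat.cast : ℕ → ℤ)) ^ k, by
      rw [← int_vecMul, pow_zero, Matrix.vecMul_one]
      congr 1
      ext i
      simp [Pi.single_apply]⟩
  have hp : (perron A : ℂ) ^ k ≠ 0 := pow_ne_zero _ (by exact_mod_cast hA.perron_pos.ne')
  obtain ⟨t, ht⟩ : ∃ t, toComplexVec A t = fun i => (u i : ℂ) := by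
    -- The unit vectors may lie outside `𝒢_A`, but `e_j A^k` does not, and `∑ u_j e_j A^k = u A^k =
    -- λ_A^k u`.
    refine ⟨((perron A : ℂ) ^ k)⁻¹ • ∑ j, (u j : ℂ) ⊗ₜ ⟨_, hmem j⟩, ?_⟩
    rw [map_smul, map_sum, inv_smul_eq_iff₀ hp, ← hpow]
    ext i
    rw [Finset.sum_apply]
    change _ = ∑ j, (u j : ℂ) * (A.map (Nat.cast : ℕ → ℂ) ^ k) j i
    refine Finset.sum_congr rfl fun j _ => ?_
    rw [toComplexVec_tmul, Pi.smul_apply, smul_eq_mul]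
    change (u j : ℂ) * (((Pi.single j (1 : ℚ) ᵥ* ratMat A ^ k) i : ℚ) : ℂ) = _
    rw [Matrix.single_one_vecMul]
    have h1 : ratMat A ^ k = (A ^ k).map (Nat.cast : ℕ → ℚ) :=
      (Matrix.map_pow A (Nat.castRingHom ℚ) k).symm
    have h2 : A.map (Nat.cast : ℕ → ℂ) ^ k = (A ^ k).map (Nat.cast : ℕ → ℂ) :=
      (Matrix.map_pow A (Nat.castRingHom ℂ) k).symm
    rw [h1, h2]
    simp [Matrix.row]
  refine ⟨t, fun h0 => ?_, toComplexVec_injective A ?_⟩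
  · obtain ⟨i⟩ := ‹Nonempty (Fin k)›
    rw [h0, map_zero] at ht
    have : (0 : ℂ) = u i := congr_fun ht i
    exact (hu0 i).ne (by exact_mod_cast this)
  · rw [toComplexVec_delta, ht, huC, map_smul, ht]

/-- Left Perron vectors are scaled by a transition matrix in the same way as right ones. -/
theorem Irred.vecMul_eq_of_mulVec_eq (hA : Irred A) {C : Matrix (Fin k) (Fin k) ℕ}
    (hC : C * A = A * C) {u v : Fin k → ℝ} {s : ℝ} (hu0 : ∀ i, 0 < u i)
    (hu : u ᵥ* A.map (Nat.cast : ℕ → ℝ) = perron A • u) (hv : IsPerronVec A v)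
    (h : C.map (Nat.cast : ℕ → ℝ) *ᵥ v = s • v) : u ᵥ* C.map (Nat.cast : ℕ → ℝ) = s • u := by
  obtain ⟨t, ht⟩ := (Matrix.IsIrreducible.transpose hA).eigenvector_unique hu0
    (w := u ᵥ* C.map (Nat.cast : ℕ → ℝ)) (by rw [Matrix.mulVec_transpose, hu]) (by
      rw [Matrix.mulVec_transpose, Matrix.vecMul_vecMul, natCast_mul_comm hC, ← Matrix.vecMul_vecMul, hu,
        Matrix.smul_vecMul])
  -- The number `u C v` is `t (u ⬝ᵥ v)` and also `s (u ⬝ᵥ v)`.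
  have h1 := Matrix.dotProduct_mulVec u (C.map (Nat.cast : ℕ → ℝ)) v
  rw [ht, h, dotProduct_smul, smul_dotProduct] at h1
  have hp : 0 < u ⬝ᵥ v :=
    Finset.sum_pos (fun i _ => mul_pos (hu0 i) (hv.1 i)) Finset.univ_nonempty
  rw [ht, mul_right_cancel₀ hp.ne' h1]

/-- The eigenspace embeds in the complex line through `u`, where `C` acts as `lam λ_A^l` and `A^l`
as `λ_A^l`; their quotient is the action of `S_φ`. -/
theorem IsTransition.isPerronEigenvalue_iff (hA : Irred A) {φ : Aut A} {l : ℕ}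
    {C : Matrix (Fin k) (Fin k) ℕ} (h : IsTransition φ l C) {lam : ℝ} {v : Fin k → ℝ}
    (hv : IsPerronVec A v) (hlam : C.map (Nat.cast : ℕ → ℝ) *ᵥ v = (lam * perron A ^ l) • v)
    (c : ℂ) : IsPerronEigenvalue hA φ c ↔ c = (lam : ℂ) := by
  obtain ⟨u, hu0, hu⟩ := hA.exists_left_eigenvector
  obtain ⟨t₀, ht₀, hδ₀⟩ := hA.exists_complexify_delta_eq hu0 hu
  obtain ⟨S, hS, hSC⟩ := h.exists_isDimRep hA
  have huC := hA.vecMul_eq_of_mulVec_eq (h.commute hA) hu0 hu hv hlam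
  have huC' : (fun i => (u i : ℂ)) ᵥ* C.map (Nat.cast : ℕ → ℂ) =
      ((lam : ℂ) * (perron A : ℂ) ^ l) • fun i => (u i : ℂ) := by
    ext i
    have := congr_arg ((↑) : ℝ → ℂ) (congr_fun huC i)
    simpa [Matrix.vecMul, dotProduct] using this
  -- Multiplying by `A^l` clears the factor `δ_A^{-l}` and leaves a relation between natural
  -- matrices.
  have hmat : ∀ x : matGroup A, (S x : Fin k → ℚ) ᵥ* ratMat (A ^ l) =
      (x : Fin k → ℚ) ᵥ* ratMat C := fun x => by
    have h1 : ratMat (A ^ l) = ratMat A ^ l := Matrix.map_pow A (Nat.castRingHom ℚ) l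
    rw [h1, ← delta_pow_coe, hSC, dimEnd_apply, ← zpow_natCast, ← LinearEquiv.mul_apply,
      ← zpow_add, add_neg_cancel, zpow_zero]
    rfl
  have hpos : (perron A : ℂ) ^ l ≠ 0 := pow_ne_zero _ (by exact_mod_cast hA.perron_pos.ne')
  have hmain : ∀ t, complexify (delta A) t = (perron A : ℂ) • t →
      complexify S t = (lam : ℂ) • t := by
    intro t ht
    have hcomm : complexify (delta A) (complexify S t) = complexify S (complexify (delta A) t) := by
      have : ∀ t, complexify (delta A) (complexify S t) =
          complexify S (complexify (delta A) t) := fun t => by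
        induction t with
        | zero => simp
        | add a b ha hb => simp only [map_add, ha, hb]
        | tmul c x => simp only [complexify_tmul, hS.comm_delta]
      exact this t
    have heig : ∀ s, complexify (delta A) s = (perron A : ℂ) • s →
        toComplexVec A s ᵥ* A.map (Nat.cast : ℕ → ℂ) = (perron A : ℂ) • toComplexVec A s :=
      fun s hs => by rw [← toComplexVec_delta, hs, map_smul]
    obtain ⟨a, ha⟩ := hA.left_eigenvector_unique hu0 hu (heig t ht)
    have hSt := heig (complexify S t) (by rw [hcomm, ht, map_smul])
    have h1 := toComplexVec_complexify hmat t
    have h2 : (A ^ l).map (Nat.cast : ℕ → ℂ) = A.map (Nat.cast : ℕ → ℂ) ^ l :=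
      Matrix.map_pow A (Nat.castRingHom ℂ) l
    rw [← Matrix.mulVec_transpose] at hSt
    rw [h2, ← Matrix.mulVec_transpose, Matrix.transpose_pow, Matrix.pow_mulVec_eq_smul hSt, ha,
      Matrix.smul_vecMul, huC'] at h1
    refine toComplexVec_injective A ?_
    rw [map_smul, ha]
    refine smul_right_injective _ hpos ?_
    simp only [h1, smul_smul]
    congr 1
    ring
  constructor
  · intro hc
    have h1 := (hc S hS t₀ hδ₀).symm.trans (hmain t₀ hδ₀)
    exact smul_left_injective ℂ ht₀ h1
  · rintro rfl T hT t ht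
    rw [hT.unique hS]
    exact hmain t ht

end SFT

/-! ### Entropy of the inverse -/

/-- Orbit segments are read backwards: if the centres `s` work for `e`, then their images under
`e^[n - 1]`, the far ends of the segments, work for `e.symm`. -/
theorem Dynamics.coverMincard_symm_le {X : Type*} (e : X ≃ X) (U : SetRel X X) (n : ℕ) :
    coverMincard e.symm univ U n ≤ coverMincard e univ U n := by
  classical
  refine le_iInf₂ fun s hs => ?_
  have hiter : ∀ j < n, ∀ z, e.symm^[j] (e^[n - 1] z) = e^[n - 1 - j] z := fun j hj z => by
    obtain ⟨d, hd⟩ : ∃ d, n - 1 = j + d := ⟨n - 1 - j, by omega⟩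
    rw [hd, Function.iterate_add_apply, (e.leftInverse_symm.iterate j).eq, show j + d - j = d by omega]
  have hcov : IsDynCoverOf e.symm univ U n (s.image e^[n - 1] : Finset X) := by
    intro y _
    obtain ⟨z, hz, hyz⟩ := hs (mem_univ (e.symm^[n - 1] y))
    refine ⟨e^[n - 1] z, by simpa using ⟨z, hz, rfl⟩, ?_⟩
    change (_, _) ∈ dynEntourage _ _ _ at hyz
    rw [mem_dynEntourage] at hyz ⊢
    intro j hj
    have h1 := hyz (n - 1 - j) (by omega)
    rw [← hiter j hj, ← hiter j hj, (e.rightInverse_symm.iterate (n - 1)).eq] at h1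
    exact h1
  exact hcov.coverMincard_le_card.trans (by exact_mod_cast Finset.card_image_le)

theorem Dynamics.coverEntropy_symm_le {X : Type*} [UniformSpace X] (e : X ≃ X) :
    coverEntropy e.symm univ ≤ coverEntropy e univ :=
  iSup₂_mono fun U _ => ExpGrowth.expGrowthSup_monotone fun n => by
    exact ENat.toENNReal_le.2 (coverMincard_symm_le e U n)

namespace SFT

variable {k : ℕ} {A : Matrix (Fin k) (Fin k) ℕ}

theorem htop_inv_le (φ : Aut A) : htop φ.inv ≤ htop φ :=
  Dynamics.coverEntropy_symm_le φ.1.toEquiv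

/-! ### Entropy and the growth of beams -/

/-- The entourage of the pairs of points that agree on `[-w, w]`. -/
def windowEntourage (A : Matrix (Fin k) (Fin k) ℕ) (w : ℕ) : SetRel (Shift A) (Shift A) :=
  {p | ∀ j : ℤ, -w ≤ j → j ≤ w → p.1 j = p.2 j}

theorem windowEntourage_mem_uniformity (w : ℕ) : windowEntourage A w ∈ uniformity (Shift A) := by
  have h : ∀ j : ℤ, {p : Shift A × Shift A | p.1 j = p.2 j} ∈ uniformity (Shift A) := fun j => by
    have hu : UniformContinuous (fun x : Shift A => x j) :=
      (Pi.uniformContinuous_proj _ j).comp uniformContinuous_subtype_val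
    have h1 : (SetRel.id : SetRel (Edge A) (Edge A)) ∈ uniformity (Edge A) := by
      rw [DiscreteUniformity.eq_principal_setRelId]
      exact mem_principal_self _
    exact hu h1
  have hw : windowEntourage A w =
      ⋂ j ∈ Finset.Icc (-(w : ℤ)) w, {p : Shift A × Shift A | p.1 j = p.2 j} := by
    ext p
    simp [windowEntourage]
  rw [hw]
  exact (biInter_finset_mem _).2 fun j _ => h j

/-- Points on a common ray whose orbits stay close together stay on common rays. -/
theorem HasRange.agree_iterate {φ : Shift A → Shift A} {r : ℕ} (h : HasRange φ r)
    {y z : Shift A} (h0 : ∀ i ≤ 0, y i = z i) {n : ℕ}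
    (hyz : ∀ j ≤ n, ∀ i : ℤ, -r ≤ i → i ≤ r → φ^[j] y i = φ^[j] z i) :
    ∀ i ≤ (r : ℤ), φ^[n] y i = φ^[n] z i := by
  have step : ∀ {y z : Shift A}, (∀ i ≤ 0, y i = z i) →
      (∀ i : ℤ, -r ≤ i → i ≤ r → y i = z i) → ∀ i ≤ (r : ℤ), y i = z i := by
    intro y z h1 h2 i hi
    rcases le_or_gt i 0 with h | h
    · exact h1 i h
    · exact h2 i (by omega) hi
  induction n with
  | zero => exact step h0 (hyz 0 le_rfl)
  | succ n ih =>
    refine step (fun i hi => ?_) (hyz (n + 1) le_rfl)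
    rw [Function.iterate_succ_apply', Function.iterate_succ_apply']
    -- One application of `φ` lowers the range of agreement from `r` to `0`; closeness on `[-r, r]`
    -- brings it back to `r`.
    exact h.agree (ih fun j hj => hyz j (by omega)) i (by omega)

theorem iterate_mapBeam (φ : Aut A) (U : Beam A) (n : ℕ) :
    (φ.mapBeam^[n] U).1 = φ^[n] '' U.1 := by
  induction n with
  | zero => simp
  | succ n ih =>
    rw [Function.iterate_succ_apply', Function.iterate_succ', image_comp, ← ih]
    rfl

variable [Nonempty (Fin k)]

theorem IsPerronVec.perronState_mono (hA : Irred A) {v : Fin k → ℝ} (hv : IsPerronVec A v)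
    {U V : Beam A} (h : U.1 ⊆ V.1) :
    perronState hA v (beamClass U) ≤ perronState hA v (beamClass V) := by
  rw [beamClass_union (U := U) (V := ⟨V.1 \ U.1, V.2.sdiff U.2⟩) (W := V) disjoint_sdiff_right
    (union_sdiff_cancel h).symm, map_add]
  exact le_add_of_nonneg_right (hv.perronState_nonneg hA _)

/-- The rays are peeled off one at a time: the part of `U` inside `R(y, w)` has state at most that
of the ray, and the rest is covered by the remaining rays. -/
theorem IsPerronVec.perronState_le_card_mul (hA : Irred A) {v : Fin k → ℝ}
    (hv : IsPerronVec A v) {w : ℤ} {K : ℝ} (hK : ∀ J, perron A ^ (-w) * v J ≤ K)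
    (t : Finset (Shift A)) (U : Beam A) (hU : U.1 ⊆ ⋃ y ∈ t, ray y w) :
    perronState hA v (beamClass U) ≤ t.card * K := by
  classical
  induction t using Finset.induction_on generalizing U with
  | empty =>
    have : U = emptyBeam := Subtype.ext (subset_empty_iff.1 (by simpa using hU))
    simp [this, beamClass_empty]
  | insert y t hy ih =>
    let V : Beam A := ⟨U.1 \ ray y w, U.2.sdiff (isBeam_ray y w)⟩
    have h1 := ih V (by
      rintro z ⟨hz, hzy⟩
      have := hU hz
      rw [Finset.set_biUnion_insert] at this
      exact this.resolve_left hzy)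
    let W : Beam A := ⟨U.1 \ V.1, U.2.sdiff V.2⟩
    have h2 : perronState hA v (beamClass W) ≤ K := by
      refine (hv.perronState_mono hA (V := rayBeam y w) fun z hz => ?_).trans ?_
      · by_contra hzy
        exact hz.2 ⟨hz.1, hzy⟩
      · rw [hv.perronState_ray hA]
        exact hK _
    rw [beamClass_union (U := V) (V := W) (W := U) disjoint_sdiff_right
      (union_sdiff_cancel sdiff_subset).symm, map_add, Finset.card_insert_of_notMem hy]
    push_cast
    linarith

/-- A factor by which `φ` scales states bounds the entropy of `φ` from below. -/
theorem IsPerronVec.log_le_htop (hA : Irred A) {v : Fin k → ℝ} (hv : IsPerronVec A v) {φ : Aut A}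
    {c : ℝ} (hc : 0 < c) (h : ∀ d, perronState hA v (φ.dimMap d) = c * perronState hA v d) :
    ((Real.log c : ℝ) : EReal) ≤ htop φ := by
  classical
  obtain ⟨i₀⟩ := id ‹Nonempty (Fin k)›
  obtain ⟨x, -⟩ := hA.exists_point 0 i₀
  obtain ⟨r, hr, -⟩ := φ.exists_range
  obtain ⟨J₀, hJ₀⟩ := Finite.exists_max fun J => perron A ^ (-(r : ℤ)) * v J
  set K := perron A ^ (-(r : ℤ)) * v J₀
  have hK : 0 < K := hv.ray_pos hA _ _
  set a := perronState hA v (beamClass (rayBeam x 0))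
  have ha : 0 < a := by
    simp only [a]
    rw [hv.perronState_ray hA]
    exact hv.ray_pos hA _ _
  have hgrow : ∀ n : ℕ, perronState hA v (beamClass (φ.mapBeam^[n] (rayBeam x 0))) = c ^ n * a := by
    intro n
    induction n with
    | zero => simp [a]
    | succ n ih =>
      rw [Function.iterate_succ_apply', ← Aut.dimMap_beamClass, h, ih]
      ring
  have hcard : ∀ (n : ℕ) (s : Finset (Shift A)),
      Dynamics.IsDynCoverOf φ univ (windowEntourage A r) (n + 1) s → c ^ n * a ≤ s.card * K := by
    intro n s hs
    let near : Shift A → Shift A → Prop := fun y z =>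
      ∀ j ≤ n, ∀ i : ℤ, -r ≤ i → i ≤ r → φ^[j] y i = φ^[j] z i
    -- A centre `z` need not lie in the ray `R(x, 0)`; it is replaced by a point of the ray close to
    -- it, whenever one exists.
    choose! g hg hnear using fun z (hz : ∃ y ∈ ray x 0, near y z) => hz
    have hsub : (φ.mapBeam^[n] (rayBeam x 0)).1 ⊆ ⋃ y ∈ s.image fun z => φ^[n] (g z), ray y r := by
      rw [iterate_mapBeam]
      rintro _ ⟨y, hy, rfl⟩
      obtain ⟨z, hz, hyz⟩ := hs (mem_univ y)
      change (_, _) ∈ Dynamics.dynEntourage _ _ _ at hyz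
      rw [Dynamics.mem_dynEntourage] at hyz
      have hyz' : near y z := fun j hj i h1 h2 => hyz j (by omega) i h1 h2
      have hex : ∃ y ∈ ray x 0, near y z := ⟨y, hy, hyz'⟩
      refine mem_biUnion (x := φ^[n] (g z)) (Finset.mem_image_of_mem (fun z => φ^[n] (g z)) hz) ?_
      refine hr.agree_iterate (fun i hi => ?_) fun j hj i h1 h2 => ?_
      · rw [hy i hi, hg z hex i hi]
      · rw [hyz' j hj i h1 h2, hnear z hex j hj i h1 h2]
    rw [← hgrow]
    refine (hv.perronState_le_card_mul hA hJ₀ _ _ hsub).trans ?_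
    refine mul_le_mul_of_nonneg_right ?_ hK.le
    exact_mod_cast Finset.card_image_le
  refine le_trans ?_ (Dynamics.coverEntropyEntourage_le_coverEntropy φ univ
    (windowEntourage_mem_uniformity r))
  -- Covers of length `n + 1` control times `0, …, n` and yield `c^n`; the extra `c` in the
  -- denominator restores the exponent `n + 1`.
  have hb : ENNReal.ofReal (a / (K * c)) ≠ 0 := by
    rw [Ne, ENNReal.ofReal_eq_zero, not_le]
    positivity
  rw [← ENNReal.log_ofReal_of_pos hc, ← ExpGrowth.expGrowthSup_pow]
  refine ExpGrowth.expGrowthSup_of_eventually_ge hb ?_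
  filter_upwards [eventually_ge_atTop 1] with n hn
  obtain ⟨n, rfl⟩ := Nat.exists_eq_add_of_le' hn
  rcases eq_or_ne (Dynamics.coverMincard φ univ (windowEntourage A r) (n + 1)) ⊤ with htop | htop
  · rw [htop]
    simp
  · obtain ⟨s, hs, hcs⟩ := (Dynamics.coverMincard_finite_iff _ _ _ _).1 htop.lt_top
    rw [← hcs, ← ENNReal.ofReal_pow hc.le, ← ENNReal.ofReal_mul (by positivity),
      ENat.toENNReal_coe, ← ENNReal.ofReal_natCast]
    refine ENNReal.ofReal_le_ofReal ?_
    have := hcard n s hs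
    rw [div_mul_eq_mul_div, div_le_iff₀ (by positivity), pow_succ]
    nlinarith

/-- With no states the shift space is empty, and the entropy of the empty set is `⊥`. -/
theorem nonempty_fin_of_htop_pos {k : ℕ} {A : Matrix (Fin k) (Fin k) ℕ}
    (h : 0 < htop (shift A)) : Nonempty (Fin k) := by
  by_contra hk
  have : IsEmpty (Shift A) := ⟨fun x => hk ⟨(x 0).src⟩⟩
  rw [htop, univ_eq_empty_iff.2 this, Dynamics.coverEntropy_empty] at h
  exact not_lt_bot h

end SFT

/-- Let `A` be an irreducible matrix whose edge shift has positive entropy, and let `φ` be an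
automorphism of the edge shift. The canonical measures on unstable sets, the states they define
on the dimension group, the automorphism `S_φ` and a Perron eigenvector of `δ_A` exist. There is
a number `lam > 0` that is the one factor by which `φ` scales these measures, the one factor by
which it scales the states, and the eigenvalue of `S_φ` on the Perron eigenvectors of `δ_A`;
and `log lam ≤ |log lam| ≤ h_top(φ)`. -/
theorem theorem3p1 {k : ℕ} (A : Matrix (Fin k) (Fin k) ℕ) (hA : SFT.Irred A)
    (hpos : 0 < SFT.htop (SFT.shift A)) (φ : SFT.Aut A) :
    (∃ μ : ∀ x : SFT.Shift A, Measure (SFT.Unstable x), SFT.IsUnstableMeasureFamily μ) ∧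
    (∀ μ : ∀ x : SFT.Shift A, Measure (SFT.Unstable x), SFT.IsUnstableMeasureFamily μ →
      ∃! τ : SFT.DimGroup A →+ ℝ, SFT.IsState μ τ) ∧
    (∃! S : SFT.MatAut A, SFT.IsDimRep hA φ S) ∧
    (∃ v : ℂ ⊗[ℤ] SFT.matGroup A, v ≠ 0 ∧
      SFT.complexify (SFT.delta A) v = (SFT.perron A : ℂ) • v) ∧
    ∃ lam : ℝ, 0 < lam ∧
      (∀ c : ℝ, SFT.ScalesMeasures φ c ↔ c = lam) ∧
      (∀ c : ℝ, SFT.ScalesState φ c ↔ c = lam) ∧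
      (∀ c : ℂ, SFT.IsPerronEigenvalue hA φ c ↔ c = (lam : ℂ)) ∧
      ((Real.log lam : ℝ) : EReal) ≤ SFT.htop φ ∧
      ((|Real.log lam| : ℝ) : EReal) ≤ SFT.htop φ := by
  have : Nonempty (Fin k) := SFT.nonempty_fin_of_htop_pos hpos
  obtain ⟨l, C, hC⟩ := SFT.exists_isTransition hA φ
  obtain ⟨l', C', hC'⟩ := SFT.exists_isTransition hA φ.inv
  obtain ⟨lam, hlam0, hlam⟩ := hC.exists_scale hA
  obtain ⟨lam', -, hlam'⟩ := hC'.exists_scale hA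
  obtain ⟨v, hv⟩ : ∃ v, SFT.IsPerronVec A v := hA.exists_right_eigenvector
  obtain ⟨u, hu0, hu⟩ := hA.exists_left_eigenvector
  have hmul : lam' * lam = 1 := hv.scale_mul_scale_inv hA (hlam v hv).2 (hlam' v hv).2
  -- Nonnegativity comes from that of `C`; the value `0` is ruled out by the factor of `φ⁻¹`.
  have hp : 0 < lam := lt_of_le_of_ne hlam0 (by rintro rfl; simp at hmul)
  have hlam'_eq : lam' = lam⁻¹ := eq_inv_of_mul_eq_one_left hmul
  have hscale := fun v hv => (hlam v hv).2
  have hle := hv.log_le_htop hA hp (hscale v hv)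
  -- The factor of `φ⁻¹` is `lam⁻¹`, so the entropy bound for the inverse controls `-log lam`.
  have hle' := (hv.log_le_htop hA (hlam'_eq ▸ inv_pos.2 hp) (hlam' v hv).2).trans
    (SFT.htop_inv_le φ)
  rw [hlam'_eq, Real.log_inv] at hle'
  obtain ⟨S, hS, -⟩ := hC.exists_isDimRep hA
  refine ⟨hA.exists_isUnstableMeasureFamily, ?_, ⟨S, hS, fun T hT => hT.unique hS⟩,
    hA.exists_complexify_delta_eq hu0 hu, lam, hp, SFT.scalesMeasures_iff hA hp hscale,
    SFT.scalesState_iff hA hscale, hC.isPerronEigenvalue_iff hA hv (hlam v hv).1, hle, ?_⟩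
  · rintro μ ⟨w, hw1, hw2, hw⟩
    exact ⟨_, SFT.IsUnstableMeasureFamily.isState hA ⟨hw1, hw2⟩ hw, fun τ hτ =>
      hτ.unique (SFT.IsUnstableMeasureFamily.isState hA ⟨hw1, hw2⟩ hw)⟩
  · rcases abs_choice (Real.log lam) with h | h
    · rwa [h]
    · rwa [h]
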